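/- Let $\mathcal C$ be a (locally small) extensive category, i.e. a category with finite coproducts and with pullbacks along coproduct coprojections, such that for every map $c\colon C'\to A+B$ and all maps $a\colon A'\to A$, $b\colon B'\to B$, $i'\colon A'\to C'$, $j'\colon B'\to C'$ forming commuting squares over the coprojections of $A+B$, the cospan $(i',j')$ is a coproduct diagram if and only if both squares are pullbacks. For $X\in\mathcal C$ let $\mathrm{Sum}_{\mathcal C}(X)$ be the Boolean algebra of isomorphism classes of coproduct coprojections $U\rightarrowtail X$, and let $\beta X$ be the set of ultrafilters on $X$, i.e. of subsets $\mathcal U\subseteq \mathrm{Sum}_{\mathcal C}(X)$ corresponding to Boolean algebra homomorphisms $\mathrm{Sum}_{\mathcal C}(X)\to 2$. For $f\colon X\to Y$ and $\mathcal U\in\beta X$ put $f_!(\mathcal U)=\{V\in \mathrm{Sum}_{\mathcal C}(Y) : f^{-1}(V)\in\mathcal U\}\in\beta Y$, where $f^{-1}$ denotes pullback along $f$. Let $\mathcal{UF}_{\mathcal C}$ be the category whose objects are the pairs $(X,\mathcal U)$ with $X\in\mathcal C$ and $\mathcal U\in\beta X$, and whose morphisms $(X,\mathcal U)\to(Y,\mathcal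 V)$ are equivalence classes of partial maps $f\colon U\to Y$ defined on the domain of some $U\rightarrowtail X$ in $\mathcal U$ which are continuous, in the sense that for all $V\in \mathrm{Sum}_{\mathcal C}(Y)$ we have $V\in\mathcal V$ if and only if the composite $f^{-1}(V)\rightarrowtail U\rightarrowtail X$ is in $\mathcal U$; two such maps defined on $U$ and $U'$ are equivalent if they agree on some $W\in\mathcal U$ with $W\subseteq U\cap U'$. Composition is composition of partial maps. Let $\mathcal E$ be a locally connected Grothendieck topos: a category equivalent to the category of sheaves of sets on a small site, such that the left adjoint $\Delta\colon\mathbf{Set}\to\mathcal E$ of $\Gamma=\mathcal E(1,-)$ has a further left adjoint $\pi_0$. Let $\mathsf{FC}(\mathcal C,\mathcal E)$ be the full subcategory of $[\mathcal C,\mathcal E]$ on the functors that preserve finite coproducts. Then there is an equivalence of categories $\mathsf{FC}(\mathcal C,\mathcal E)\simeq[\mathcal{UF}_{\mathcal C},\mathcal E]$ whose two directions $A\mapsto\tilde A$ and $B\mapsto\int\! B$ are given as follows. (a) For $A\in\mathsf{FC}(\mathcal C,\mathcal E)$, each map $AU\to AX$ with $U\in\mathrm{Sum}_{\mathcal C}(X)$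 belonging to an ultrafilter $\mathcal U\in\beta X$ is monic, and $$\tilde A(X,\mathcal U)=\bigcap_{U\in\mathcal U}AU\;\subseteq\;AX .$$ If a morphism $(X,\mathcal U)\to(Y,\mathcal V)$ of $\mathcal{UF}_{\mathcal C}$ is represented by $f\colon U\to Y$ with $m\colon U\rightarrowtail X$ in $\mathcal U$, then $\tilde A$ sends it to the map whose composite with $\tilde A(Y,\mathcal V)\rightarrowtail AY$ is $\tilde A(X,\mathcal U)\to AU\xrightarrow{Af}AY$, where the first map is the lifting of $\tilde A(X,\mathcal U)\rightarrowtail AX$ through $Am$. Transformations $A\Rightarrow A'$ act by restriction. (b) For $B\in[\mathcal{UF}_{\mathcal C},\mathcal E]$, $$\Bigl(\int\! B\Bigr)X=\sum_{\mathcal U\in\beta X}B(X,\mathcal U),$$ and for $f\colon X\to Y$ the map $(\int\! B)f$ sends the summand $B(X,\mathcal U)$ to the summand $B(Y,f_!(\mathcal U))$ via the action of $B$ on the morphism $(X,\mathcal U)\to(Y,f_!(\mathcal U))$ represented by $f$. Transformations $B\Rightarrow B'$ act summandwise. Moreover, the isomorphism $\widetilde{\int\! B}\cong B$ of the equivalence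 (its counit) is compatible with the inclusion $\widetilde{\int\! B}(X,\mathcal U)\rightarrowtail(\int\! B)X$ of (a) and the coprojection $B(X,\mathcal U)\to(\int\! B)X$ of (b). -/

import Mathlib

open CategoryTheory CategoryTheory.Limits

universe u₂ u₁ w u v

namespace ExtensiveUltrafilters

/-! ### Coproduct coprojections -/

section Coprojections

variable {C : Type u} [Category.{v} C]

/-- `m : A ⟶ X` and `n : B ⟶ X` exhibit `X` as a coproduct of `A` and `B`. -/
def IsCoproduct {A B X : C} (m : A ⟶ X) (n : B ⟶ X) : Prop :=
  Nonempty (IsColimit (BinaryCofan.mk m n))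

/-- `m : A ⟶ X` is a coproduct coprojection: it is one leg of a binary coproduct diagram. -/
def IsCoprojection {A X : C} (m : A ⟶ X) : Prop :=
  ∃ (B : C) (n : B ⟶ X), IsCoproduct m n

theorem IsCoproduct.symm {A B X : C} {m : A ⟶ X} {n : B ⟶ X} (h : IsCoproduct m n) :
    IsCoproduct n m :=
  h.map fun h' => BinaryCofan.isColimitFlip h'

theorem IsCoproduct.left {A B X : C} {m : A ⟶ X} {n : B ⟶ X} (h : IsCoproduct m n) :
    IsCoprojection m := ⟨B, n, h⟩

theorem IsCoproduct.right {A B X : C} {m : A ⟶ X} {n : B ⟶ X} (h : IsCoproduct m n) :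
    IsCoprojection n := h.symm.left

theorem IsCoproduct.exists_desc {A B X T : C} {m : A ⟶ X} {n : B ⟶ X} (h : IsCoproduct m n)
    (f : A ⟶ T) (g : B ⟶ T) : ∃ k : X ⟶ T, m ≫ k = f ∧ n ≫ k = g := by
  obtain ⟨h⟩ := h
  obtain ⟨l, h1, h2⟩ := BinaryCofan.IsColimit.desc' h f g
  exact ⟨l, h1, h2⟩

theorem IsCoproduct.hom_ext {A B X T : C} {m : A ⟶ X} {n : B ⟶ X} (h : IsCoproduct m n)
    {f g : X ⟶ T} (h1 : m ≫ f = m ≫ g) (h2 : n ≫ f = n ≫ g) : f = g := by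
  obtain ⟨h⟩ := h
  exact BinaryCofan.IsColimit.hom_ext h h1 h2

theorem IsCoproduct.mk' {A B X : C} {m : A ⟶ X} {n : B ⟶ X}
    (hd : ∀ {T : C} (f : A ⟶ T) (g : B ⟶ T), ∃ k : X ⟶ T, m ≫ k = f ∧ n ≫ k = g)
    (he : ∀ {T : C} (f g : X ⟶ T), m ≫ f = m ≫ g → n ≫ f = n ≫ g → f = g) :
    IsCoproduct m n := by
  choose k h1 h2 using @hd
  exact ⟨BinaryCofan.IsColimit.mk _ (fun f g => k f g) (fun f g => h1 f g) (fun f g => h2 f g)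
    (fun f g l hf hg => he _ _ (hf.trans (h1 f g).symm) (hg.trans (h2 f g).symm))⟩

theorem IsCoproduct.iso_left {A A' B X : C} {m : A ⟶ X} {n : B ⟶ X} (h : IsCoproduct m n)
    (e : A' ≅ A) : IsCoproduct (e.hom ≫ m) n := by
  refine IsCoproduct.mk' (fun f g => ?_) (fun f g h1 h2 => ?_)
  · obtain ⟨k, h1, h2⟩ := h.exists_desc (e.inv ≫ f) g
    exact ⟨k, by rw [Category.assoc, h1, e.hom_inv_id_assoc], h2⟩
  · refine h.hom_ext ?_ h2
    simpa using h1

theorem IsCoprojection.iso_comp {A A' X : C} {m : A ⟶ X} (h : IsCoprojection m)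
    (e : A' ≅ A) : IsCoprojection (e.hom ≫ m) := by
  obtain ⟨B, n, h⟩ := h
  exact (h.iso_left e).left

variable [FinitaryExtensive C]

theorem isCoproduct_id (X : C) : IsCoproduct (𝟙 X) (initial.to X) :=
  IsCoproduct.mk' (fun f g => ⟨f, by simp, Subsingleton.elim _ _⟩)
    (fun f g h1 _ => by simpa using h1)

theorem IsCoprojection.mono {A X : C} {m : A ⟶ X} (h : IsCoprojection m) : Mono m := by
  obtain ⟨B, n, ⟨h⟩⟩ := h
  exact FinitaryExtensive.mono_inl_of_isColimit h

theorem IsCoprojection.comp {A B X : C} {k : A ⟶ B} {m : B ⟶ X}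
    (hk : IsCoprojection k) (hm : IsCoprojection m) : IsCoprojection (k ≫ m) := by
  obtain ⟨A', k', hk⟩ := hk
  obtain ⟨B', m', hm⟩ := hm
  refine ⟨A' ⨿ B', coprod.desc (k' ≫ m) m', IsCoproduct.mk' (fun f g => ?_)
    (fun f g h1 h2 => ?_)⟩
  · obtain ⟨p, p1, p2⟩ := hk.exists_desc f (coprod.inl ≫ g)
    obtain ⟨q, q1, q2⟩ := hm.exists_desc p (coprod.inr ≫ g)
    refine ⟨q, by rw [Category.assoc, q1, p1], ?_⟩
    apply coprod.hom_ext
    · rw [coprod.inl_desc_assoc, Category.assoc, q1, p2]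
    · rw [coprod.inr_desc_assoc, q2]
  · have h3 := congrArg (coprod.inl ≫ ·) h2
    have h4 := congrArg (coprod.inr ≫ ·) h2
    simp only [coprod.inl_desc_assoc, coprod.inr_desc_assoc, Category.assoc] at h1 h3 h4
    exact hm.hom_ext (hk.hom_ext h1 h3) h4

theorem IsCoprojection.hasPullback {A X Y : C} {m : A ⟶ Y} (h : IsCoprojection m) (f : X ⟶ Y) :
    HasPullback f m := by
  obtain ⟨B, n, ⟨h⟩⟩ := h
  let e : A ⨿ B ≅ Y := (coprodIsCoprod A B).coconePointUniqueUpToIso h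
  have he : coprod.inl ≫ e.hom = m :=
    (coprodIsCoprod A B).comp_coconePointUniqueUpToIso_hom h ⟨WalkingPair.left⟩
  have h1 : IsPullback (𝟙 X) (f ≫ e.inv) f e.hom := IsPullback.of_horiz_isIso ⟨by simp⟩
  have h2 := (IsPullback.of_hasPullback (f ≫ e.inv) (coprod.inl : A ⟶ A ⨿ B)).paste_horiz
    h1.flip.flip
  rw [he] at h2
  exact ⟨⟨⟨_, h2.isLimit⟩⟩⟩

theorem IsCoproduct.of_isPullback {A B X Y A' B' : C} {m : A ⟶ Y} {n : B ⟶ Y}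
    (h : IsCoproduct m n) {f : X ⟶ Y} {m' : A' ⟶ X} {n' : B' ⟶ X} {fA : A' ⟶ A} {fB : B' ⟶ B}
    (hA : IsPullback m' fA f m) (hB : IsPullback n' fB f n) : IsCoproduct m' n' := by
  obtain ⟨h⟩ := h
  exact ((BinaryCofan.isVanKampen_iff _).1 (FinitaryExtensive.van_kampen' _ h)
    (BinaryCofan.mk m' n') fA fB f hA.w.symm hB.w.symm).2 ⟨hA, hB⟩

theorem IsCoprojection.of_isPullback {A X Y A' : C} {m : A ⟶ Y} (h : IsCoprojection m)
    {f : X ⟶ Y} {m' : A' ⟶ X} {fA : A' ⟶ A} (hA : IsPullback m' fA f m) : IsCoprojection m' := by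
  obtain ⟨B, n, h⟩ := h
  have := h.right.hasPullback f
  exact (h.of_isPullback hA (IsPullback.of_hasPullback f n)).left

theorem IsCoprojection.pullback_fst {A X Y : C} {m : A ⟶ Y} (h : IsCoprojection m) (f : X ⟶ Y)
    [HasPullback f m] : IsCoprojection (pullback.fst f m) :=
  h.of_isPullback (IsPullback.of_hasPullback f m)

/-- A map factors through one summand iff its intersection with the other one is initial. -/
theorem IsCoproduct.factors_iff {A B X T S : C} {m : A ⟶ X} {n : B ⟶ X} (h : IsCoproduct m n)
    {t : T ⟶ X} {s : S ⟶ T} {s' : S ⟶ A} (hS : IsPullback s s' t m) :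
    (∃ k, k ≫ n = t) ↔ Nonempty (S ⟶ ⊥_ C) := by
  constructor
  · rintro ⟨k, rfl⟩
    obtain ⟨h⟩ := h
    have := FinitaryExtensive.isPullback_initial_to_binaryCofan h
    exact ⟨this.lift s' (s ≫ k) (hS.w.symm.trans (Category.assoc _ _ _).symm)⟩
  · rintro ⟨i⟩
    have := h.right.hasPullback t
    have h2 := h.of_isPullback hS (IsPullback.of_hasPullback t n)
    obtain ⟨k, -, hk⟩ := h2.exists_desc (i ≫ initial.to _) (pullback.snd t n)
    refine ⟨k, h2.hom_ext ?_ ?_⟩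
    · have : IsIso i := inferInstance
      rw [← cancel_epi (inv i)]
      exact Subsingleton.elim _ _
    · rw [reassoc_of% hk, pullback.condition]

end Coprojections

/-! ### The Boolean algebra of coproduct summands -/

section Summands

variable {C : Type u} [Category.{v} C]

/-- `Sum_C(X)`: the poset of isomorphism classes of coproduct coprojections with codomain `X`.
(In an extensive category coprojections are monic, so these classes are subobjects.) -/
def Summand (X : C) : Type (max u v) :=
  {P : Subobject X // IsCoprojection P.arrow}

instance (X : C) : PartialOrder (Summand X) :=
  inferInstanceAs (PartialOrder {P : Subobject X // IsCoprojection P.arrow})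

namespace Summand

/-- The domain of (a chosen representative of) a summand. -/
noncomputable def dom {X : C} (U : Summand X) : C := (U.1 : C)

/-- The coprojection representing a summand. -/
noncomputable def arrow {X : C} (U : Summand X) : U.dom ⟶ X := U.1.arrow

theorem arrow_isCoprojection {X : C} (U : Summand X) : IsCoprojection U.arrow := U.2

variable [FinitaryExtensive C] {X Y Z : C}

/-- The summand represented by a coprojection. -/
noncomputable def mk {A : C} (m : A ⟶ X) (h : IsCoprojection m) : Summand X :=
  have := h.mono
  ⟨Subobject.mk m, by
    rw [← Subobject.underlyingIso_hom_comp_eq_mk]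
    exact h.iso_comp _⟩

theorem mk_arrow (U : Summand X) : mk U.arrow U.arrow_isCoprojection = U :=
  Subtype.ext (Subobject.mk_arrow U.1)

theorem mk_le_mk {A B : C} {m : A ⟶ X} {n : B ⟶ X} {hm : IsCoprojection m}
    {hn : IsCoprojection n} : mk m hm ≤ mk n hn ↔ ∃ k, k ≫ n = m := by
  have := hm.mono
  have := hn.mono
  constructor
  · intro h
    have h' : Subobject.mk m ≤ Subobject.mk n := h
    exact ⟨Subobject.ofMkLEMk m n h', Subobject.ofMkLEMk_comp h'⟩
  · rintro ⟨k, hk⟩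
    exact Subobject.mk_le_mk_of_comm k hk

theorem rep (U : Summand X) : ∃ (A : C) (m : A ⟶ X) (h : IsCoprojection m), U = mk m h :=
  ⟨_, U.arrow, U.arrow_isCoprojection, U.mk_arrow.symm⟩

theorem ext_le {U V : Summand X}
    (h : ∀ {A : C} (m : A ⟶ X) (hm : IsCoprojection m), mk m hm ≤ U ↔ mk m hm ≤ V) : U = V := by
  apply le_antisymm
  · rw [← U.mk_arrow]
    exact (h _ U.arrow_isCoprojection).1 U.mk_arrow.le
  · rw [← V.mk_arrow]
    exact (h _ V.arrow_isCoprojection).2 V.mk_arrow.le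

theorem mk_le_iff {A : C} {m : A ⟶ X} {hm : IsCoprojection m} {U : Summand X} :
    mk m hm ≤ U ↔ ∃ k, k ≫ U.arrow = m := by
  conv_lhs => rw [← U.mk_arrow]
  exact mk_le_mk

/-- The inverse image `f⁻¹(V)` of a summand: the pullback of its coprojection along `f`. -/
noncomputable def preimage (f : X ⟶ Y) (V : Summand Y) : Summand X :=
  have := V.arrow_isCoprojection.hasPullback f
  mk (pullback.fst f V.arrow) (V.arrow_isCoprojection.pullback_fst f)

/-- The image of a summand `W ↣ A` under a coprojection `m : A ⟶ X`: the composite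
`W ↣ A ↣ X`. -/
noncomputable def image {A : C} (m : A ⟶ X) (hm : IsCoprojection m) (W : Summand A) : Summand X :=
  mk (W.arrow ≫ m) (W.arrow_isCoprojection.comp hm)

theorem le_preimage {A : C} {t : A ⟶ X} {ht : IsCoprojection t} {f : X ⟶ Y} {V : Summand Y} :
    mk t ht ≤ preimage f V ↔ ∃ k, k ≫ V.arrow = t ≫ f := by
  have := V.arrow_isCoprojection.hasPullback f
  rw [preimage, mk_le_mk]
  constructor
  · rintro ⟨k, rfl⟩
    exact ⟨k ≫ pullback.snd f V.arrow, by
      rw [Category.assoc, ← pullback.condition, Category.assoc]⟩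
  · rintro ⟨k, hk⟩
    exact ⟨pullback.lift t k hk.symm, pullback.lift_fst _ _ _⟩

theorem le_preimage_mk {A B : C} {t : A ⟶ X} {ht : IsCoprojection t} {f : X ⟶ Y} {n : B ⟶ Y}
    {hn : IsCoprojection n} : mk t ht ≤ preimage f (mk n hn) ↔ ∃ k, k ≫ n = t ≫ f := by
  rw [le_preimage]
  obtain ⟨a, ha⟩ := mk_le_mk.1 (mk n hn).mk_arrow.le
  obtain ⟨b, hb⟩ := mk_le_mk.1 (mk n hn).mk_arrow.ge
  constructor
  · rintro ⟨k, hk⟩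
    exact ⟨k ≫ a, by rw [Category.assoc, ha, hk]⟩
  · rintro ⟨k, hk⟩
    exact ⟨k ≫ b, by rw [Category.assoc, hb, hk]⟩

theorem le_image {A B : C} {t : B ⟶ X} {ht : IsCoprojection t} {m : A ⟶ X}
    {hm : IsCoprojection m} {W : Summand A} :
    mk t ht ≤ image m hm W ↔ ∃ k, k ≫ W.arrow ≫ m = t := mk_le_mk

theorem preimage_mk_of_isPullback {A A' : C} {f : X ⟶ Y} {m : A ⟶ Y} {m' : A' ⟶ X}
    {fA : A' ⟶ A} (hm : IsCoprojection m) (h : IsPullback m' fA f m) :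
    preimage f (mk m hm) = mk m' (hm.of_isPullback h) := by
  refine ext_le fun t ht => ?_
  rw [le_preimage_mk, mk_le_mk]
  constructor
  · rintro ⟨k, hk⟩
    exact ⟨h.lift t k hk.symm, by simp⟩
  · rintro ⟨k, rfl⟩
    exact ⟨k ≫ fA, by rw [Category.assoc, ← h.w, Category.assoc]⟩

noncomputable instance : Min (Summand X) :=
  ⟨fun U V => image U.arrow U.arrow_isCoprojection (preimage U.arrow V)⟩

theorem mk_le_inf {A : C} {t : A ⟶ X} {ht : IsCoprojection t} {U V : Summand X} :
    mk t ht ≤ U ⊓ V ↔ mk t ht ≤ U ∧ mk t ht ≤ V := by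
  have := U.arrow_isCoprojection.mono
  change mk t ht ≤ image U.arrow U.arrow_isCoprojection (preimage U.arrow V) ↔ _
  rw [le_image]
  constructor
  · rintro ⟨k, rfl⟩
    obtain ⟨l, hl⟩ := le_preimage.1 (preimage U.arrow V).mk_arrow.le
    exact ⟨mk_le_iff.2 ⟨k ≫ (preimage U.arrow V).arrow, by simp⟩,
      mk_le_iff.2 ⟨k ≫ l, by simp [hl]⟩⟩
  · rintro ⟨h1, h2⟩
    obtain ⟨a, rfl⟩ := mk_le_iff.1 h1
    obtain ⟨b, hb⟩ := mk_le_iff.1 h2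
    have := V.arrow_isCoprojection.hasPullback U.arrow
    obtain ⟨l, hl⟩ := (mk_le_iff (hm := V.arrow_isCoprojection.pullback_fst U.arrow)).1
      (le_refl (preimage U.arrow V))
    refine ⟨pullback.lift a b hb.symm ≫ l, ?_⟩
    rw [Category.assoc, reassoc_of% hl, pullback.lift_fst_assoc]

noncomputable instance : SemilatticeInf (Summand X) where
  inf := (· ⊓ ·)
  inf_le_left U V := by
    rw [← (U ⊓ V).mk_arrow]
    exact (mk_le_inf.1 (U ⊓ V).mk_arrow.le).1
  inf_le_right U V := by
    rw [← (U ⊓ V).mk_arrow]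
    exact (mk_le_inf.1 (U ⊓ V).mk_arrow.le).2
  le_inf T U V h1 h2 := by
    rw [← T.mk_arrow] at h1 h2 ⊢
    exact mk_le_inf.2 ⟨h1, h2⟩

noncomputable instance : OrderTop (Summand X) where
  top := mk (𝟙 X) (isCoproduct_id X).left
  le_top U := by
    rw [← U.mk_arrow]
    exact mk_le_mk.2 ⟨U.arrow, by simp⟩

noncomputable instance : OrderBot (Summand X) where
  bot := mk (initial.to X) (isCoproduct_id X).right
  bot_le U := by
    rw [← U.mk_arrow]
    exact mk_le_mk.2 ⟨initial.to _, Subsingleton.elim _ _⟩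

/-- The complement of a summand: the other summand of a binary coproduct decomposition. -/
noncomputable instance : Compl (Summand X) :=
  ⟨fun U => mk U.arrow_isCoprojection.choose_spec.choose
    U.arrow_isCoprojection.choose_spec.choose_spec.right⟩

theorem inf_eq_bot_iff {A B : C} {m : A ⟶ X} {n : B ⟶ X} (h : IsCoproduct m n)
    (T : Summand X) : T ⊓ mk m h.left = ⊥ ↔ T ≤ mk n h.right := by
  have := h.left.hasPullback T.arrow
  have hS := IsPullback.of_hasPullback T.arrow m
  have hp := (h.left.pullback_fst T.arrow).comp T.arrow_isCoprojection
  have e : T ⊓ mk m h.left = mk (pullback.fst T.arrow m ≫ T.arrow) hp := by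
    refine ext_le fun t ht => ?_
    rw [mk_le_inf, mk_le_iff, mk_le_mk, mk_le_mk]
    constructor
    · rintro ⟨⟨a, ha⟩, ⟨b, hb⟩⟩
      exact ⟨pullback.lift a b (ha.trans hb.symm), by
        rw [pullback.lift_fst_assoc, ha]⟩
    · rintro ⟨k, rfl⟩
      exact ⟨⟨k ≫ pullback.fst _ _, Category.assoc _ _ _⟩, ⟨k ≫ pullback.snd _ _, by
        rw [Category.assoc, ← pullback.condition]⟩⟩
  rw [e, ← le_bot_iff]
  conv_rhs => rw [← T.mk_arrow]
  rw [mk_le_mk, h.factors_iff hS]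
  change mk _ _ ≤ mk (initial.to X) _ ↔ _
  rw [mk_le_mk]
  constructor
  · rintro ⟨k, -⟩
    exact ⟨k⟩
  · rintro ⟨k⟩
    refine ⟨k, ?_⟩
    have : IsIso k := inferInstance
    rw [← cancel_epi (inv k)]
    exact Subsingleton.elim _ _

theorem inf_eq_bot_iff_le_compl (T U : Summand X) : T ⊓ U = ⊥ ↔ T ≤ Uᶜ := by
  conv_lhs => rw [← U.mk_arrow]
  exact inf_eq_bot_iff U.arrow_isCoprojection.choose_spec.choose_spec T

theorem compl_mk {A B : C} {m : A ⟶ X} {n : B ⟶ X} (h : IsCoproduct m n) :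
    (mk m h.left)ᶜ = mk n h.right :=
  ext_le fun t ht => by rw [← inf_eq_bot_iff_le_compl, inf_eq_bot_iff h]

theorem compl_compl' (U : Summand X) : Uᶜᶜ = U := by
  have h := U.arrow_isCoprojection.choose_spec.choose_spec
  exact (compl_mk h.symm).trans U.mk_arrow

/-- A meet semilattice with an involutive pseudocomplement is a Boolean algebra. -/
@[reducible] def booleanAlgebraOfCompl {P : Type*} [SemilatticeInf P] [OrderTop P] [OrderBot P]
    [Compl P] (h : ∀ a b : P, a ⊓ b = ⊥ ↔ a ≤ bᶜ) (hc : ∀ a : P, aᶜᶜ = a) :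
    BooleanAlgebra P where
  inf := (· ⊓ ·)
  sup a b := (aᶜ ⊓ bᶜ)ᶜ
  le_sup_left a b := by
    rw [← h, ← inf_assoc, (h a aᶜ).2 (hc a).ge, bot_inf_eq]
  le_sup_right a b := by
    rw [← h, inf_comm aᶜ, ← inf_assoc, (h b bᶜ).2 (hc b).ge, bot_inf_eq]
  sup_le a b d h1 h2 := by
    have anti : ∀ x y : P, x ≤ y → yᶜ ≤ xᶜ := fun x y hxy => by
      rw [← h, ← le_bot_iff]
      calc yᶜ ⊓ x ≤ yᶜ ⊓ y := inf_le_inf_left _ hxy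
        _ = ⊥ := (h _ _).2 le_rfl
    calc (aᶜ ⊓ bᶜ)ᶜ ≤ dᶜᶜ := anti _ _ (le_inf (anti _ _ h1) (anti _ _ h2))
      _ = d := hc d
  inf_le_left _ _ := inf_le_left
  inf_le_right _ _ := inf_le_right
  le_inf _ _ _ := le_inf
  le_sup_inf x y z := by
    change (xᶜ ⊓ yᶜ)ᶜ ⊓ (xᶜ ⊓ zᶜ)ᶜ ≤ (xᶜ ⊓ (y ⊓ z)ᶜ)ᶜ
    have key : ∀ w y : P, w ≤ (xᶜ ⊓ yᶜ)ᶜ ↔ w ⊓ xᶜ ≤ y := fun w y => by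
      rw [← h, ← inf_assoc, h, hc]
    rw [key]
    exact le_inf ((key _ _).1 inf_le_left) ((key _ _).1 inf_le_right)
  top := ⊤
  bot := ⊥
  le_top _ := le_top
  bot_le _ := bot_le
  inf_compl_le_bot x := ((h _ _).2 (hc x).ge).le
  top_le_sup_compl x := by
    change ⊤ ≤ (xᶜ ⊓ xᶜᶜ)ᶜ
    rw [← h, inf_comm xᶜ, (h xᶜᶜ xᶜ).2 le_rfl, inf_bot_eq]

/-- The poset of summands of an object of an extensive category is a Boolean algebra. -/
noncomputable instance : BooleanAlgebra (Summand X) :=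
  booleanAlgebraOfCompl inf_eq_bot_iff_le_compl compl_compl'

theorem preimage_top (f : X ⟶ Y) : preimage f (⊤ : Summand Y) = ⊤ := by
  refine ext_le fun t ht => ?_
  change mk t ht ≤ preimage f (mk (𝟙 Y) _) ↔ _
  rw [le_preimage_mk]
  exact ⟨fun _ => le_top, fun _ => ⟨t ≫ f, by simp⟩⟩

theorem preimage_inf (f : X ⟶ Y) (U V : Summand Y) :
    preimage f (U ⊓ V) = preimage f U ⊓ preimage f V := by
  refine ext_le fun t ht => ?_
  rw [mk_le_inf, le_preimage, le_preimage, le_preimage]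
  have := U.arrow_isCoprojection.mono
  constructor
  · rintro ⟨k, hk⟩
    obtain ⟨a, ha⟩ := mk_le_iff.1 (((U ⊓ V).mk_arrow.le).trans inf_le_left)
    obtain ⟨b, hb⟩ := mk_le_iff.1 (((U ⊓ V).mk_arrow.le).trans inf_le_right)
    exact ⟨⟨k ≫ a, by rw [Category.assoc, ha, hk]⟩, ⟨k ≫ b, by rw [Category.assoc, hb, hk]⟩⟩
  · rintro ⟨⟨a, ha⟩, ⟨b, hb⟩⟩
    have := V.arrow_isCoprojection.hasPullback U.arrow
    have e : mk (pullback.fst U.arrow V.arrow ≫ U.arrow)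
        ((V.arrow_isCoprojection.pullback_fst U.arrow).comp U.arrow_isCoprojection) ≤ U ⊓ V :=
      mk_le_inf.2 ⟨mk_le_iff.2 ⟨pullback.fst _ _, rfl⟩,
        mk_le_iff.2 ⟨pullback.snd _ _, pullback.condition.symm⟩⟩
    obtain ⟨l, hl⟩ := mk_le_iff.1 e
    exact ⟨pullback.lift a b (ha.trans hb.symm) ≫ l, by
      rw [Category.assoc, hl, pullback.lift_fst_assoc, ha]⟩

theorem preimage_compl (f : X ⟶ Y) (U : Summand Y) : preimage f Uᶜ = (preimage f U)ᶜ := by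
  have h := U.arrow_isCoprojection.choose_spec.choose_spec
  have := h.left.hasPullback f
  have := h.right.hasPullback f
  have hA := IsPullback.of_hasPullback f U.arrow
  have hB := IsPullback.of_hasPullback f U.arrow_isCoprojection.choose_spec.choose
  exact (preimage_mk_of_isPullback h.right hB).trans (compl_mk (h.of_isPullback hA hB)).symm

theorem preimage_id (U : Summand X) : preimage (𝟙 X) U = U :=
  ext_le fun t ht => by rw [le_preimage, mk_le_iff, Category.comp_id]

theorem image_id (h : IsCoprojection (𝟙 X)) (U : Summand X) : image (𝟙 X) h U = U :=
  ext_le fun t ht => by rw [le_image, mk_le_iff, Category.comp_id]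

theorem preimage_comp (f : X ⟶ Y) (g : Y ⟶ Z) (U : Summand Z) :
    preimage (f ≫ g) U = preimage f (preimage g U) := by
  have := U.arrow_isCoprojection.hasPullback g
  refine ext_le fun t ht => ?_
  conv_rhs => rw [preimage.eq_1 g U]
  rw [le_preimage, le_preimage_mk]
  constructor
  · rintro ⟨k, hk⟩
    exact ⟨pullback.lift (t ≫ f) k ((Category.assoc _ _ _).trans hk.symm),
      pullback.lift_fst _ _ _⟩
  · rintro ⟨k, hk⟩
    exact ⟨k ≫ pullback.snd _ _, by
      rw [Category.assoc, ← pullback.condition, reassoc_of% hk]⟩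

theorem image_comp {A B : C} {k : A ⟶ B} {m : B ⟶ X} (hk : IsCoprojection k)
    (hm : IsCoprojection m) (U : Summand A) :
    image (k ≫ m) (hk.comp hm) U = image m hm (image k hk U) := by
  have := hm.mono
  refine ext_le fun t ht => ?_
  obtain ⟨a, ha⟩ := mk_le_mk.1 (image k hk U).mk_arrow.le
  obtain ⟨b, hb⟩ := mk_le_mk.1 (image k hk U).mk_arrow.ge
  rw [le_image, le_image]
  constructor
  · rintro ⟨l, rfl⟩
    exact ⟨l ≫ b, by rw [Category.assoc, reassoc_of% hb]⟩
  · rintro ⟨l, rfl⟩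
    exact ⟨l ≫ a, by rw [← ha]; simp⟩

theorem preimage_image {A A' : C} {f : X ⟶ Y} {m : A ⟶ Y} {m' : A' ⟶ X} {fA : A' ⟶ A}
    (hm : IsCoprojection m) (h : IsPullback m' fA f m) (S : Summand A) :
    preimage f (image m hm S) = image m' (hm.of_isPullback h) (preimage fA S) := by
  have := S.arrow_isCoprojection.hasPullback fA
  have hp := IsPullback.of_hasPullback fA S.arrow
  have e := preimage_mk_of_isPullback (S.arrow_isCoprojection.comp hm)
    (hp.flip.paste_vert h.flip).flip
  refine e.trans ?_
  refine ext_le fun t ht => ?_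
  have hc := S.arrow_isCoprojection.pullback_fst fA
  obtain ⟨a, ha⟩ := (mk_le_mk (hn := hc)).1 (preimage fA S).mk_arrow.le
  obtain ⟨b, hb⟩ := (mk_le_iff (hm := hc)).1 (le_refl (preimage fA S))
  rw [mk_le_mk, le_image]
  constructor
  · rintro ⟨l, rfl⟩
    exact ⟨l ≫ b, by rw [Category.assoc, reassoc_of% hb]⟩
  · rintro ⟨l, rfl⟩
    exact ⟨l ≫ a, by rw [← ha]; simp⟩

end Summand

end Summands

/-! ### Ultrafilters and the category `UF_C` -/

section Ultrafilters

variable {C : Type u} [Category.{v} C] [FinitaryExtensive C]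

/-- An ultrafilter on `X`: a subset of the Boolean algebra `Sum_C(X)` which is the preimage of
`⊤` under a Boolean algebra homomorphism `Sum_C(X) → 2`. The type of these is `β X`. -/
@[ext]
structure UltrafilterOn (X : C) where
  carrier : Set (Summand X)
  top_mem : ⊤ ∈ carrier
  inf_mem_iff : ∀ U V : Summand X, U ⊓ V ∈ carrier ↔ U ∈ carrier ∧ V ∈ carrier
  mem_iff_compl_notMem : ∀ U : Summand X, U ∈ carrier ↔ Uᶜ ∉ carrier

instance (X : C) : Membership (Summand X) (UltrafilterOn X) := ⟨fun 𝒰 U => U ∈ 𝒰.carrier⟩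

theorem UltrafilterOn.mem_of_le {X : C} (𝒰 : UltrafilterOn X) {U V : Summand X} (hU : U ∈ 𝒰)
    (h : U ≤ V) : V ∈ 𝒰 := by
  rw [← inf_eq_left.2 h] at hU
  exact ((𝒰.inf_mem_iff U V).1 hU).2

/-- The pushforward `f_!(𝒰) = {V | f⁻¹(V) ∈ 𝒰}`, that is, the action of `β` on morphisms. -/
noncomputable def UltrafilterOn.push {X Y : C} (f : X ⟶ Y) (𝒰 : UltrafilterOn X) :
    UltrafilterOn Y where
  carrier := {V | V.preimage f ∈ 𝒰}
  top_mem := by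
    change Summand.preimage f ⊤ ∈ 𝒰
    rw [Summand.preimage_top]
    exact 𝒰.top_mem
  inf_mem_iff U V := by
    change Summand.preimage f (U ⊓ V) ∈ 𝒰 ↔ _
    rw [Summand.preimage_inf]
    exact 𝒰.inf_mem_iff _ _
  mem_iff_compl_notMem U := by
    change _ ↔ ¬ Summand.preimage f Uᶜ ∈ 𝒰
    rw [Summand.preimage_compl]
    exact 𝒰.mem_iff_compl_notMem _

variable (C) in
/-- Objects of `UF_C`: pairs of an object `X` of `C` and an ultrafilter on `X`. -/
structure UF where
  obj : C
  uf : UltrafilterOn obj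

/-- A partial continuous map `(X, 𝒰) ⇀ (Y, 𝒱)`: a map `map : dom ⟶ Y` defined on the domain of
some summand `incl : dom ↣ X` in `𝒰`, such that `V ↣ Y` is in `𝒱` just when
`map⁻¹(V) ↣ dom ↣ X` is in `𝒰`. -/
structure PartialMap (P Q : UF C) where
  dom : C
  incl : dom ⟶ P.obj
  isCoprojection : IsCoprojection incl
  mem : Summand.mk incl isCoprojection ∈ P.uf
  map : dom ⟶ Q.obj
  continuous : ∀ V : Summand Q.obj,
    V ∈ Q.uf ↔ Summand.image incl isCoprojection (V.preimage map) ∈ P.uf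

namespace PartialMap

/-- `=_𝒰`-equivalence: two partial maps are identified if their restrictions to some member
`w : W ↣ X` of `𝒰` contained in both domains coincide. -/
def Equivalent {P Q : UF C} (f g : PartialMap P Q) : Prop :=
  ∃ (W : C) (w : W ⟶ P.obj) (hw : IsCoprojection w) (a : W ⟶ f.dom) (b : W ⟶ g.dom),
    Summand.mk w hw ∈ P.uf ∧ a ≫ f.incl = w ∧ b ≫ g.incl = w ∧ a ≫ f.map = b ≫ g.map

instance setoid (P Q : UF C) : Setoid (PartialMap P Q) where
  r := Equivalent
  iseqv :=
    { refl := fun f => ⟨f.dom, f.incl, f.isCoprojection, 𝟙 _, 𝟙 _, f.mem, by simp⟩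
      symm := fun ⟨W, w, hw, a, b, h, h1, h2, h3⟩ => ⟨W, w, hw, b, a, h, h2, h1, h3.symm⟩
      trans := by
        rintro f g k ⟨W, w, hw, a, b, h, h1, h2, h3⟩ ⟨W', w', hw', a', b', h', h1', h2', h3'⟩
        have := g.isCoprojection.mono
        obtain ⟨c, hc⟩ := Summand.mk_le_mk.1 (((Summand.mk w hw ⊓ Summand.mk w' hw').mk_arrow.le).trans
          inf_le_left)
        obtain ⟨d, hd⟩ := Summand.mk_le_mk.1 (((Summand.mk w hw ⊓ Summand.mk w' hw').mk_arrow.le).trans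
          inf_le_right)
        have e : c ≫ b = d ≫ a' := by
          rw [← cancel_mono g.incl, Category.assoc, Category.assoc, h2, h1', hc, hd]
        refine ⟨_, (Summand.mk w hw ⊓ Summand.mk w' hw').arrow,
          Summand.arrow_isCoprojection _, c ≫ a, d ≫ b', ?_, ?_, ?_, ?_⟩
        · rw [Summand.mk_arrow]
          exact (P.uf.inf_mem_iff _ _).2 ⟨h, h'⟩
        · rw [Category.assoc, h1, hc]
        · rw [Category.assoc, h2', hd]
        · rw [Category.assoc, h3, reassoc_of% e, h3', Category.assoc] }

/-- A totally defined continuous map, as a partial map. -/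
noncomputable def ofTotal {P Q : UF C} (f : P.obj ⟶ Q.obj)
    (hf : ∀ V : Summand Q.obj, V ∈ Q.uf ↔ V.preimage f ∈ P.uf) : PartialMap P Q where
  dom := P.obj
  incl := 𝟙 _
  isCoprojection := (isCoproduct_id _).left
  mem := P.uf.top_mem
  map := f
  continuous V := by rw [hf, Summand.image_id]

/-- The identity partial map. -/
noncomputable def id (P : UF C) : PartialMap P P :=
  ofTotal (𝟙 P.obj) fun V => by rw [Summand.preimage_id]

/-- Composition of partial maps: the composite of `f : U ⟶ Y` and `g : V ⟶ Z` is defined on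
`f⁻¹(V) ↣ U ↣ X`. -/
noncomputable def comp {P Q R : UF C} (f : PartialMap P Q) (g : PartialMap Q R) :
    PartialMap P R :=
  have hp := g.isCoprojection.hasPullback f.map
  { dom := pullback f.map g.incl
    incl := pullback.fst f.map g.incl ≫ f.incl
    isCoprojection := (g.isCoprojection.pullback_fst f.map).comp f.isCoprojection
    mem := by
      have h := (f.continuous _).1 g.mem
      rw [Summand.preimage_mk_of_isPullback g.isCoprojection
        (IsPullback.of_hasPullback f.map g.incl)] at h
      refine P.uf.mem_of_le h ?_
      obtain ⟨l, hl⟩ := (Summand.mk_le_mk (hn := g.isCoprojection.pullback_fst f.map)).1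
        (Summand.mk_arrow _).le
      exact Summand.mk_le_mk.2 ⟨l, by rw [← Category.assoc, hl]⟩
    map := pullback.snd f.map g.incl ≫ g.map
    continuous := fun V => by
      rw [g.continuous, f.continuous, Summand.preimage_image g.isCoprojection
        (IsPullback.of_hasPullback f.map g.incl), ← Summand.image_comp, Summand.preimage_comp] }

theorem exists_lift_comp {P Q R : UF C} (f : PartialMap P Q) (g : PartialMap Q R) {T : C}
    (a : T ⟶ f.dom) (b : T ⟶ g.dom) (h : a ≫ f.map = b ≫ g.incl) :
    ∃ c : T ⟶ (f.comp g).dom,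
      c ≫ (f.comp g).incl = a ≫ f.incl ∧ c ≫ (f.comp g).map = b ≫ g.map := by
  have hp := g.isCoprojection.hasPullback f.map
  exact ⟨pullback.lift a b h, pullback.lift_fst_assoc _ _ _ _, pullback.lift_snd_assoc _ _ _ _⟩

theorem exists_proj_comp {P Q R : UF C} (f : PartialMap P Q) (g : PartialMap Q R) :
    ∃ (a : (f.comp g).dom ⟶ f.dom) (b : (f.comp g).dom ⟶ g.dom), a ≫ f.map = b ≫ g.incl ∧
      (f.comp g).incl = a ≫ f.incl ∧ (f.comp g).map = b ≫ g.map := by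
  have hp := g.isCoprojection.hasPullback f.map
  exact ⟨pullback.fst f.map g.incl, pullback.snd f.map g.incl, pullback.condition, rfl, rfl⟩

theorem comp_equivalent {P Q R : UF C} {f f' : PartialMap P Q} {g g' : PartialMap Q R}
    (hf : f ≈ f') (hg : g ≈ g') : f.comp g ≈ f'.comp g' := by
  obtain ⟨W, w, hw, a, b, h, h1, h2, h3⟩ := hf
  obtain ⟨W', w', hw', a', b', h', h1', h2', h3'⟩ := hg
  have hq := hw'.hasPullback (a ≫ f.map)
  have hc := hw'.pullback_fst (a ≫ f.map)
  have := f.isCoprojection.mono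
  have hcond := pullback.condition (f := a ≫ f.map) (g := w')
  obtain ⟨c, c1, c2⟩ := exists_lift_comp f g (pullback.fst (a ≫ f.map) w' ≫ a)
    (pullback.snd (a ≫ f.map) w' ≫ a') (by rw [Category.assoc, Category.assoc, h1', hcond])
  obtain ⟨d, d1, d2⟩ := exists_lift_comp f' g' (pullback.fst (a ≫ f.map) w' ≫ b)
    (pullback.snd (a ≫ f.map) w' ≫ b') (by rw [Category.assoc, Category.assoc, h2', ← h3, hcond])
  refine ⟨pullback (a ≫ f.map) w', pullback.fst _ _ ≫ w, hc.comp hw, c, d, ?_, ?_, ?_, ?_⟩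
  · have hm := (P.uf.inf_mem_iff _ _).2 ⟨h, (f.continuous _).1 h'⟩
    refine P.uf.mem_of_le hm ?_
    rw [← Summand.mk_arrow (_ ⊓ _)]
    obtain ⟨c, hc⟩ := Summand.mk_le_mk.1 ((Summand.mk_arrow (Summand.mk w hw ⊓
      Summand.image f.incl f.isCoprojection
        (Summand.preimage f.map (Summand.mk w' hw')))).le.trans inf_le_left)
    obtain ⟨d, hd⟩ := Summand.le_image.1 ((Summand.mk_arrow (Summand.mk w hw ⊓
      Summand.image f.incl f.isCoprojection
        (Summand.preimage f.map (Summand.mk w' hw')))).le.trans inf_le_right)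
    obtain ⟨k, hk⟩ := Summand.le_preimage_mk.1
      (Summand.preimage f.map (Summand.mk w' hw')).mk_arrow.le
    have e : c ≫ a = d ≫ (Summand.preimage f.map (Summand.mk w' hw')).arrow := by
      rw [← cancel_mono f.incl, Category.assoc, h1, hc, Category.assoc, hd]
    refine Summand.mk_le_mk.2 ⟨pullback.lift c (d ≫ k) ?_, ?_⟩
    · rw [Category.assoc, hk, reassoc_of% e]
    · rw [pullback.lift_fst_assoc, hc]
  · rw [c1, Category.assoc, h1]
  · rw [d1, Category.assoc, h2]
  · rw [c2, d2, Category.assoc, h3', Category.assoc]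

/-- Partial maps are equivalent as soon as one restricts to the other. -/
theorem equivalent_of_factors {P Q : UF C} {f g : PartialMap P Q} (a : f.dom ⟶ g.dom)
    (h1 : a ≫ g.incl = f.incl) (h2 : a ≫ g.map = f.map) : f ≈ g :=
  ⟨f.dom, f.incl, f.isCoprojection, 𝟙 _, a, f.mem, by simp, h1, by simp [h2]⟩

theorem id_comp {P Q : UF C} (f : PartialMap P Q) : (PartialMap.id P).comp f ≈ f := by
  obtain ⟨a, b, h, h1, h2⟩ := exists_proj_comp (PartialMap.id P) f
  exact equivalent_of_factors b (h.symm.trans h1.symm) h2.symm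

theorem comp_id {P Q : UF C} (f : PartialMap P Q) : f.comp (PartialMap.id Q) ≈ f := by
  obtain ⟨a, b, h, h1, h2⟩ := exists_proj_comp f (PartialMap.id Q)
  exact equivalent_of_factors a h1.symm (h.trans h2.symm)

theorem assoc {P Q R S : UF C} (f : PartialMap P Q) (g : PartialMap Q R) (k : PartialMap R S) :
    (f.comp g).comp k ≈ f.comp (g.comp k) := by
  obtain ⟨a, b, h, h1, h2⟩ := exists_proj_comp f g
  obtain ⟨a', b', h', h1', h2'⟩ := exists_proj_comp (f.comp g) k
  obtain ⟨c, c1, c2⟩ := exists_lift_comp g k (a' ≫ b) b' (by rw [Category.assoc, ← h2, h'])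
  obtain ⟨d, d1, d2⟩ := exists_lift_comp f (g.comp k) (a' ≫ a) c (by
    rw [c1, Category.assoc, h, Category.assoc])
  exact equivalent_of_factors d (by rw [d1, h1', h1, Category.assoc]) (by rw [d2, c2, h2'])

end PartialMap

/-- The category `UF_C`: morphisms are `=_𝒰`-equivalence classes of partial continuous maps. -/
noncomputable instance : Category.{max u v} (UF C) where
  Hom P Q := Quotient (PartialMap.setoid P Q)
  id P := Quotient.mk _ (PartialMap.id P)
  comp f g := Quotient.map₂ PartialMap.comp (fun _ _ hf _ _ hg => PartialMap.comp_equivalent hf hg) f g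
  id_comp := by
    rintro P Q ⟨f⟩
    exact Quotient.sound f.id_comp
  comp_id := by
    rintro P Q ⟨f⟩
    exact Quotient.sound f.comp_id
  assoc := by
    rintro P Q R S ⟨f⟩ ⟨g⟩ ⟨k⟩
    exact Quotient.sound (f.assoc g k)

/-- The morphism of `UF_C` represented by a partial continuous map. -/
noncomputable def PartialMap.toHom {P Q : UF C} (f : PartialMap P Q) : P ⟶ Q :=
  Quotient.mk (PartialMap.setoid P Q) f

/-- The morphism `(X, 𝒰) ⟶ (Y, f_!(𝒰))` of `UF_C` represented by the total map `f : X ⟶ Y`. -/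
noncomputable def UF.pushHom {X Y : C} (f : X ⟶ Y) (𝒰 : UltrafilterOn X) :
    (⟨X, 𝒰⟩ : UF C) ⟶ ⟨Y, 𝒰.push f⟩ :=
  (PartialMap.ofTotal (P := ⟨X, 𝒰⟩) (Q := ⟨Y, 𝒰.push f⟩) f fun _ => Iff.rfl).toHom

end Ultrafilters

/-! ### Locally connected Grothendieck toposes -/

section Toposes

/-- A Grothendieck topos: a (locally small) category equivalent to the category of sheaves of sets
on a small site. -/
def IsGrothendieckTopos (E : Type u) [Category.{w} E] : Prop :=
  ∃ (S : Type w) (_ : SmallCategory S) (J : GrothendieckTopology S),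
    Nonempty (E ≌ Sheaf J (Type w))

/-- `E` is locally connected: the global sections functor `Γ = E(1, -)` has a left adjoint `Δ`,
which has a further left adjoint `π₀`. -/
def IsLocallyConnected (E : Type u) [Category.{w} E] : Prop :=
  ∃ (T : E) (_ : IsTerminal T) (Δ : Type w ⥤ E) (π₀ : E ⥤ Type w),
    Nonempty (Δ ⊣ coyoneda.obj (Opposite.op T)) ∧ Nonempty (π₀ ⊣ Δ)

end Toposes

/-! ### Finite-coproduct-preserving functors and the two explicit formulas -/

section Formulas

variable (C : Type u) [Category.{v} C] (E : Type u₁) [Category.{w} E]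

/-- `FC(C, E)`: the full subcategory of `C ⥤ E` on the finite-coproduct-preserving functors. -/
abbrev FC : Type (max v w u u₁) :=
  ObjectProperty.FullSubcategory (fun F : C ⥤ E => PreservesFiniteCoproducts F)

variable {C E}

/-- `j : Z ⟶ Y` exhibits `Z` as the intersection `⋂ᵢ Aᵢ ⊆ Y` of the family of subobjects
`aᵢ : Aᵢ ↣ Y`: all these maps are monic, and a map into `Y` factors through `j` just when it
factors through every `aᵢ`. -/
structure IsIntersection {I : Type u₂} {Y Z : E} {A : I → E} (a : ∀ i, A i ⟶ Y) (j : Z ⟶ Y) :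
    Prop where
  mono_family : ∀ i, Mono (a i)
  mono : Mono j
  factors_iff : ∀ {T : E} (t : T ⟶ Y), (∃ h, h ≫ j = t) ↔ ∀ i, ∃ k, k ≫ a i = t

variable [FinitaryExtensive C]

/-- The functor `A ↦ Ã` from `FC(C, E)` to `[UF_C, E]` is given by
`Ã(X, 𝒰) = ⋂_{U ∈ 𝒰} AU ⊆ AX`, with inclusions `j A (X, 𝒰) : Ã(X, 𝒰) ↣ AX`. -/
structure IsIntersectionOfImages (Φ : FC C E ⥤ (UF C ⥤ E))
    (j : ∀ (A : FC C E) (P : UF C), (Φ.obj A).obj P ⟶ A.obj.obj P.obj) : Prop where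
  /-- `Ã(X, 𝒰)` is the intersection of the subobjects `AU ↣ AX` for `U ∈ 𝒰`. -/
  isIntersection : ∀ (A : FC C E) (P : UF C),
    IsIntersection (fun U : {U : Summand P.obj // U ∈ P.uf} => A.obj.map U.1.arrow) (j A P)
  /-- The value of `Ã` at the class of a partial map `f` defined on `m : U ↣ X` in `𝒰` sends `x`
  to `Af(x')`, where `x'` is the lifting of `x` through `Am : AU ↣ AX`. -/
  map_partialMap : ∀ (A : FC C E) {P Q : UF C} (f : PartialMap P Q)
    (l : (Φ.obj A).obj P ⟶ A.obj.obj f.dom), l ≫ A.obj.map f.incl = j A P →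
      (Φ.obj A).map f.toHom ≫ j A Q = l ≫ A.obj.map f.map
  /-- The action on a transformation `α : A ⟶ A'` is the restriction of the components of `α`. -/
  map_natTrans : ∀ {A A' : FC C E} (α : A ⟶ A') (P : UF C),
    (Φ.map α).app P ≫ j A' P = j A P ≫ α.hom.app P.obj

/-- The functor `B ↦ ∫B` from `[UF_C, E]` to `FC(C, E)` is given by
`(∫B) X = ∑_{𝒰 ∈ βX} B(X, 𝒰)`, with coprojections `i B X 𝒰 : B(X, 𝒰) ⟶ (∫B) X`. -/
structure IsSumOverUltrafilters (Ψ : (UF C ⥤ E) ⥤ FC C E)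
    (i : ∀ (B : UF C ⥤ E) (X : C) (𝒰 : UltrafilterOn X),
      B.obj ⟨X, 𝒰⟩ ⟶ (Ψ.obj B).obj.obj X) : Prop where
  /-- `(∫B) X` is the coproduct of the `B(X, 𝒰)` over all ultrafilters `𝒰` on `X`. -/
  isCoproduct : ∀ (B : UF C ⥤ E) (X : C),
    Nonempty (IsColimit (Cofan.mk ((Ψ.obj B).obj.obj X) (i B X)))
  /-- `(∫B) f` sends the summand at `𝒰` to the one at `f_!(𝒰)`, via `B f`. -/
  map_hom : ∀ (B : UF C ⥤ E) {X Y : C} (f : X ⟶ Y) (𝒰 : UltrafilterOn X),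
    i B X 𝒰 ≫ (Ψ.obj B).obj.map f = B.map (UF.pushHom f 𝒰) ≫ i B Y (𝒰.push f)
  /-- The action on a transformation `γ : B ⟶ B'` is the sum of the components of `γ`. -/
  map_natTrans : ∀ {B B' : UF C ⥤ E} (γ : B ⟶ B') (X : C) (𝒰 : UltrafilterOn X),
    i B X 𝒰 ≫ (Ψ.map γ).hom.app X = γ.app ⟨X, 𝒰⟩ ≫ i B' X 𝒰

end Formulas

end ExtensiveUltrafilters

open ExtensiveUltrafilters

/-! ### Small coproducts in a Grothendieck topos -/

namespace ExtensiveUltrafilters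

/-! In a locally connected topos every object is a small coproduct of connected objects, so
subobjects, isomorphisms and coproduct diagrams can be tested on elements `x : T ⟶ Z` with `T`
connected. On such elements a coproduct behaves as it does in sets: each element lies in exactly one
summand and lifts to it uniquely. The decomposition
(`IsGrothendieckTopos.hasConnectedDecompositions`) comes from pulling the unit `Z ⟶ Δ π₀ Z` back
along the points of `π₀ Z`; it rests on coproducts being van Kampen.

Let `F` preserve finite coproducts and let `x : T ⟶ F X` be an element with `T` connected. For each
summand `U` of `X`, the object `F X` is the coproduct of `F U` and `F Uᶜ`, so `x` lies in exactly
one of the two. Hence the summands `U` with `x` in `F U` form an ultrafilter on `X`, the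
`elementUltrafilter` of `x`. It is pushed forward by maps of `C`, and is unchanged by
reparametrizing `T` and by natural transformations. The elements with ultrafilter `𝒰` are exactly
those of the intersection of the `F U` for `U ∈ 𝒰`, because ultrafilters are maximal. Since each
element has exactly one ultrafilter, `F X` is the coproduct of these intersections, here called
stalks (`isIso_sumStalk`).

Conversely, for `U ∈ 𝒰` the inclusion of `U` with the restricted ultrafilter is an isomorphism onto
`(X, 𝒰)` in `UF C` (`UF.isIso_total`). Elements of the summand `B(X, 𝒰)` of `∫ B` therefore lift to
`(∫ B) U` for every `U ∈ 𝒰`, so their ultrafilter is `𝒰` and the stalk of `∫ B` at `(X, 𝒰)` is `B(X,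
𝒰)` (`isStalk_ultraSumι`). That `∫ B` preserves binary coproducts reflects the fact that an
ultrafilter on a coproduct contains exactly one of the two summands (`isCoproduct_ultraSumMap`). -/

theorem exists_discrete_functor_eq {I : Type*} {D : Type*} [Category* D] (F : Discrete I ⥤ D) :
    ∃ X : I → D, F = Discrete.functor X :=
  ⟨F.obj ∘ Discrete.mk,
    Functor.hext (fun i ↦ rfl) (by rintro ⟨i⟩ ⟨j⟩ ⟨⟨rfl : i = j⟩⟩; simp)⟩

/-- Coproducts of sets are van Kampen. -/
theorem isVanKampenColimit_coproduct_types {I : Type w} (F : Discrete I ⥤ Type w) (c : Cocone F)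
    (hc : IsColimit c) : IsVanKampenColimit c := by
  obtain ⟨X, rfl⟩ := exists_discrete_functor_eq F
  intro F' c' α f h _
  obtain ⟨X', rfl⟩ := exists_discrete_functor_eq F'
  have hα : ∀ (i : I) (x : X' i), f (Cofan.inj c' i x) = Cofan.inj c i (α.app ⟨i⟩ x) :=
    fun i x => (ConcreteCategory.congr_hom (NatTrans.congr_app h ⟨i⟩) x).symm
  constructor
  · rintro ⟨hc'⟩ ⟨i⟩
    rw [Types.isPullback_iff]
    refine ⟨(NatTrans.congr_app h ⟨i⟩).symm, ?_, ?_⟩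
    · rintro x y ⟨hxy, -⟩
      exact Cofan.inj_injective_of_isColimit (c := c') hc' i hxy
    · intro z y hzy
      obtain ⟨j, x, rfl⟩ := Cofan.inj_jointly_surjective_of_isColimit (c := c') hc' z
      have e := (hα j x).symm.trans hzy
      obtain rfl := Cofan.eq_of_inj_apply_eq_of_isColimit (c := c) hc _ _ e
      exact ⟨x, rfl, Cofan.inj_injective_of_isColimit (c := c) hc _ e⟩
  · intro H
    have H' := fun i : I => (Types.isPullback_iff _ _ _ _).1 (H ⟨i⟩)
    refine (Cofan.nonempty_isColimit_iff_bijective_fromSigma (c := c')).2 ⟨?_, ?_⟩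
    · rintro ⟨i, x⟩ ⟨j, y⟩ hxy
      change Cofan.inj c' i x = Cofan.inj c' j y at hxy
      have e : Cofan.inj c i (α.app ⟨i⟩ x) = Cofan.inj c j (α.app ⟨j⟩ y) := by
        rw [← hα, ← hα, hxy]
      obtain rfl := Cofan.eq_of_inj_apply_eq_of_isColimit (c := c) hc _ _ e
      obtain rfl := (H' i).2.1 x y ⟨hxy, Cofan.inj_injective_of_isColimit (c := c) hc _ e⟩
      rfl
    · intro z
      obtain ⟨i, x, hx⟩ := Cofan.inj_jointly_surjective_of_isColimit (c := c) hc (f z)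
      obtain ⟨y, hy, -⟩ := (H' i).2.2 z x hx.symm
      exact ⟨⟨i, y⟩, hy⟩

/-- Small coproducts in a Grothendieck topos are van Kampen. -/
theorem IsGrothendieckTopos.isVanKampenColimit_coproduct {E : Type u} [Category.{w} E]
    (hE : IsGrothendieckTopos.{w} E) {I : Type w} (F : Discrete I ⥤ E) (c : Cocone F)
    (hc : IsColimit c) : IsVanKampenColimit c := by
  obtain ⟨S, _, J, ⟨e⟩⟩ := hE
  let Gl : (Sᵒᵖ ⥤ Type w) ⥤ E := presheafToSheaf J (Type w) ⋙ e.inverse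
  let Gr : E ⥤ (Sᵒᵖ ⥤ Type w) := e.functor ⋙ sheafToPresheaf J (Type w)
  let adj : Gl ⊣ Gr := (sheafificationAdjunction J (Type w)).comp e.symm.toAdjunction
  have : Gr.Full := inferInstanceAs (e.functor ⋙ sheafToPresheaf J (Type w)).Full
  have : Gr.Faithful := inferInstanceAs (e.functor ⋙ sheafToPresheaf J (Type w)).Faithful
  have : PreservesFiniteLimits Gl :=
    inferInstanceAs (PreservesFiniteLimits (presheafToSheaf J (Type w) ⋙ e.inverse))
  have : PreservesColimitsOfSize.{w, w} Gl := adj.leftAdjoint_preservesColimits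
  -- In presheaves the property is checked objectwise, where it reduces to sets; the left exact
  -- reflection `Gl` then carries it over to `E`.
  have vk : IsVanKampenColimit (colimit.cocone (F ⋙ Gr)) :=
    isVanKampenColimit_of_evaluation _ _ fun x =>
      isVanKampenColimit_coproduct_types _ _
        (isColimitOfPreserves ((evaluation _ _).obj x) (colimit.isColimit _))
  apply (IsVanKampenColimit.precompose_isIso_iff
    (Functor.isoWhiskerLeft _ (asIso adj.counit) ≪≫ Functor.rightUnitor _).hom).mp
  refine (vk.map_reflective adj).of_iso (IsColimit.uniqueUpToIso ?_ ?_)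
  · exact isColimitOfPreserves Gl (colimit.isColimit _)
  · exact (IsColimit.precomposeHomEquiv _ _).symm hc

theorem IsGrothendieckTopos.hasCoproducts {E : Type u} [Category.{w} E]
    (hE : IsGrothendieckTopos.{w} E) : HasCoproducts.{w} E := by
  obtain ⟨S, _, J, ⟨e⟩⟩ := hE
  intro I
  have : HasColimitsOfShape (Discrete I) (Sheaf J (Type w)) :=
    hasColimitsOfShape_of_reflective (sheafToPresheaf J (Type w))
  exact Adjunction.hasColimitsOfShape_of_equivalence e.functor

theorem IsGrothendieckTopos.hasPullbacks {E : Type u} [Category.{w} E]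
    (hE : IsGrothendieckTopos.{w} E) : HasPullbacks E := by
  obtain ⟨S, _, J, ⟨e⟩⟩ := hE
  have : HasPullbacks (Sheaf J (Type w)) := inferInstance
  exact Adjunction.hasLimitsOfShape_of_equivalence e.functor

/-- `T` is connected: maps out of `T` into a small coproduct factor uniquely through exactly one
of the summands. -/
def IsConnectedObj {E : Type u} [Category.{w} E] (T : E) : Prop :=
  ∀ ⦃I : Type w⦄ (X : I → E) (P : E) (c : ∀ i, X i ⟶ P), IsColimit (Cofan.mk P c) →
    ∀ f : T ⟶ P, ∃! p : Σ i, (T ⟶ X i), p.2 ≫ c p.1 = f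

/-- Every object is a small coproduct of connected objects. -/
def HasConnectedDecompositions (E : Type u) [Category.{w} E] : Prop :=
  ∀ Z : E, ∃ (I : Type w) (K : I → E) (k : ∀ i, K i ⟶ Z),
    (∀ i, IsConnectedObj (K i)) ∧ Nonempty (IsColimit (Cofan.mk Z k))

/-! ### Connected components in a locally connected topos -/

section LocallyConnected

variable {E : Type u} [Category.{w} E]

/-- The coproduct of copies of the terminal set indexed by `I` is `I`. -/
theorem isColimit_punit_cofan (I : Type w) :
    Nonempty (IsColimit (Cofan.mk (f := fun _ : I => (PUnit.{w + 1} : Type w)) I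
      fun i => ↾fun _ => i)) := by
  rw [Cofan.nonempty_isColimit_iff_bijective_fromSigma]
  constructor
  · rintro ⟨i, ⟨⟩⟩ ⟨j, ⟨⟩⟩ h
    obtain rfl : i = j := h
    rfl
  · intro i
    exact ⟨⟨i, ⟨⟩⟩, rfl⟩

/-- In a category whose coproducts are van Kampen, a cofan over `X` is a coproduct if and only if
its legs are the pullbacks of the coprojections of a constant object `Δ I`. -/
theorem nonempty_isColimit_iff_isPullback_of_isVanKampen
    (hvk : ∀ ⦃I : Type w⦄ (F : Discrete I ⥤ E) (c : Cocone F), IsColimit c → IsVanKampenColimit c)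
    {Δ : Type w ⥤ E} [Δ.IsLeftAdjoint] {I : Type w} {X : I → E} {P : E} (c : ∀ i, X i ⟶ P)
    (t : ∀ i, X i ⟶ Δ.obj PUnit) (f : P ⟶ Δ.obj I)
    (h : ∀ i, c i ≫ f = t i ≫ Δ.map (↾fun _ => i)) :
    Nonempty (IsColimit (Cofan.mk P c)) ↔
      ∀ i, IsPullback (c i) (t i) f (Δ.map (↾fun _ => i)) := by
  -- As a left adjoint, `Δ` turns the decomposition of `I` into points into a coproduct, to which
  -- the van Kampen property applies.
  have hΔ := isColimitCofanMkObjOfIsColimit Δ _ _ (isColimit_punit_cofan I).some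
  refine (hvk _ _ hΔ (Cofan.mk P c) (Discrete.natTrans fun i => t i.as) f ?_
    (NatTrans.Equifibered.of_discrete _)).trans ⟨fun H i => H ⟨i⟩, fun H i => H i.as⟩
  ext ⟨i⟩
  exact (h i).symm

/-- A coproduct indexed by `I` maps to `Δ I` by recording the index. Composing `f` with this map and
transposing gives a function `π₀ T → I`, which is constant because `π₀ T` is a singleton. Its value
is the index of the only summand through which `f` can factor, and that summand is a pullback of a
point of `Δ I`. -/
theorem isConnectedObj_of_unique_component
    (hvk : ∀ ⦃I : Type w⦄ (F : Discrete I ⥤ E) (c : Cocone F), IsColimit c → IsVanKampenColimit c)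
    {Δ : Type w ⥤ E} {π₀ : E ⥤ Type w} [Δ.IsLeftAdjoint] (adj : π₀ ⊣ Δ)
    (hT : IsTerminal (Δ.obj PUnit)) {T : E} (h1 : Nonempty (π₀.obj T))
    (h2 : Subsingleton (π₀.obj T)) : IsConnectedObj T := by
  intro I X P c hc f
  let d : P ⟶ Δ.obj I := Cofan.IsColimit.desc hc fun i => hT.from _ ≫ Δ.map (↾fun _ => i)
  have hd : ∀ i, c i ≫ d = hT.from _ ≫ Δ.map (↾fun _ => i) := fun i =>
    Cofan.IsColimit.fac hc (fun i => hT.from _ ≫ Δ.map (↾fun _ => i)) i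
  have hp := (nonempty_isColimit_iff_isPullback_of_isVanKampen hvk c _ d hd).1 ⟨hc⟩
  obtain ⟨x⟩ := h1
  have hconst : ∀ i, (adj.homEquiv T I).symm (hT.from T ≫ Δ.map (↾fun _ => i)) x = i := by
    intro i
    rw [Adjunction.homEquiv_naturality_right_symm]
    rfl
  have hi : f ≫ d = hT.from T ≫ Δ.map (↾fun _ => (adj.homEquiv T I).symm (f ≫ d) x) := by
    apply (adj.homEquiv T I).symm.injective
    ext y
    obtain rfl := Subsingleton.elim x y
    exact (hconst _).symm
  refine ⟨⟨_, (hp _).lift f (hT.from T) hi⟩, (hp _).lift_fst _ _ hi, ?_⟩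
  rintro ⟨j, g⟩ rfl
  have hj : (adj.homEquiv T I).symm ((g ≫ c j) ≫ d) x = j := by
    rw [Category.assoc, hd, ← Category.assoc, hT.hom_ext (g ≫ _) (hT.from T), hconst]
  -- The index is generalized so that the equation with `j` can be substituted in the dependent
  -- pair.
  have key : ∀ i (hi : (g ≫ c j) ≫ d = hT.from T ≫ Δ.map (↾fun _ => i)), j = i →
      (⟨j, g⟩ : Σ i, (T ⟶ X i)) = ⟨i, (hp i).lift (g ≫ c j) (hT.from T) hi⟩ := by
    rintro i hi rfl
    congr 1
    apply (hp j).hom_ext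
    · simp
    · exact hT.hom_ext _ _
  exact key _ hi hj.symm

/-- The components are the fibres of the unit `Z ⟶ Δ π₀ Z` over the points `p` of `π₀ Z`. Since `π₀`
preserves this coproduct, `π₀ Z` is the disjoint union of the `π₀` of the fibres. The fibre over `p`
contributes only the value `p`, hence exactly one point. -/
theorem hasConnectedDecompositions_of_isVanKampen [HasPullbacks E]
    (hvk : ∀ ⦃I : Type w⦄ (F : Discrete I ⥤ E) (c : Cocone F), IsColimit c → IsVanKampenColimit c)
    {Δ : Type w ⥤ E} {π₀ : E ⥤ Type w} [Δ.IsLeftAdjoint] (adj : π₀ ⊣ Δ) :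
    HasConnectedDecompositions E := by
  intro Z
  have := adj.rightAdjoint_preservesLimits
  have := adj.leftAdjoint_preservesColimits
  have hT : IsTerminal (Δ.obj PUnit) := Types.isTerminalPUnit.isTerminalObj Δ
  let e (p : π₀.obj Z) : (PUnit : Type w) ⟶ π₀.obj Z := ↾fun _ => p
  let u : Z ⟶ Δ.obj (π₀.obj Z) := adj.unit.app Z
  have hu : (adj.homEquiv _ _).symm u = 𝟙 _ := adj.homEquiv_symm_unit Z
  obtain ⟨hc⟩ := (nonempty_isColimit_iff_isPullback_of_isVanKampen hvk
    (fun p => pullback.fst u (Δ.map (e p))) (fun p => pullback.snd u (Δ.map (e p))) u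
    (fun p => pullback.condition)).2 fun p => IsPullback.of_hasPullback _ _
  refine ⟨π₀.obj Z, _, _, fun p => ?_, ⟨hc⟩⟩
  have hπ := isColimitCofanMkObjOfIsColimit π₀ _ _ hc
  -- Transposing the pullback square across `π₀ ⊣ Δ` turns the unit into the identity and the point
  -- `q` into a constant function.
  have hval : ∀ q (x : π₀.obj (pullback u (Δ.map (e q)))),
      π₀.map (pullback.fst u (Δ.map (e q))) x = q := by
    intro q x
    have h := congrArg (adj.homEquiv _ _).symm (pullback.condition (f := u) (g := Δ.map (e q)))
    rw [Adjunction.homEquiv_naturality_right_symm, Adjunction.homEquiv_naturality_left_symm,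
      hu, Category.comp_id] at h
    rw [h]
    rfl
  refine isConnectedObj_of_unique_component hvk adj hT ?_ ⟨fun x y => ?_⟩
  · obtain ⟨q, x, hx⟩ := Cofan.inj_jointly_surjective_of_isColimit hπ p
    obtain rfl : q = p := (hval q x).symm.trans hx
    exact ⟨x⟩
  · exact Cofan.inj_injective_of_isColimit hπ p ((hval p x).trans (hval p y).symm)

theorem IsGrothendieckTopos.hasConnectedDecompositions (hE : IsGrothendieckTopos.{w} E)
    (hlc : IsLocallyConnected.{w} E) : HasConnectedDecompositions E := by
  obtain ⟨_, _, Δ, π₀, ⟨adj'⟩, ⟨adj⟩⟩ := hlc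
  have := hE.hasPullbacks
  have := adj'.isLeftAdjoint
  exact hasConnectedDecompositions_of_isVanKampen (fun _ => hE.isVanKampenColimit_coproduct) adj

end LocallyConnected

/-! ### Detection by connected objects -/

section ConnectedDetection

variable {E : Type u} [Category.{w} E]

namespace IsConnectedObj

variable {T : E} (hT : IsConnectedObj T)

include hT

/-- Connectedness quantifies over index types in `Type w`, whereas ultrafilters on `X` form only an
essentially `w`-small type; the coproduct is reindexed along `equivShrink`. -/
theorem existsUnique_of_small {I : Type v} [Small.{w} I] {X : I → E} {P : E} {c : ∀ i, X i ⟶ P}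
    (hc : IsColimit (Cofan.mk P c)) (f : T ⟶ P) :
    ∃! p : Σ i, (T ⟶ X i), p.2 ≫ c p.1 = f := by
  let e := equivShrink.{w} I
  have hc' : IsColimit (Cofan.mk P fun j => c (e.symm j)) :=
    Cofan.IsColimit.mk _ (fun s => Cofan.IsColimit.desc hc fun i =>
        eqToHom (by simp) ≫ s.inj (e i))
      (fun s j => by
        refine (Cofan.IsColimit.fac hc _ _).trans ?_
        obtain ⟨i, rfl⟩ := e.surjective j
        -- The indices `e.symm (e i)` and `i` are only propositionally equal, so the summands are
        -- compared through `eqToHom`.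
        have key : ∀ (i' : I) (h : i' = i),
            eqToHom (by simp [h]) ≫ s.inj (e i') =
              (eqToHom (by simp [h]) : X i' ⟶ X (e.symm (e i))) ≫ s.inj (e i) := by
          rintro _ rfl
          rfl
        rw [key _ (e.symm_apply_apply i), eqToHom_refl]
        exact Category.id_comp _)
      (fun s m hm => Cofan.IsColimit.hom_ext hc _ _ fun i => by
        refine Eq.trans ?_ (Cofan.IsColimit.fac hc _ _).symm
        have key : ∀ (i' : I) (h : i' = i), c i ≫ m = eqToHom (by rw [h]) ≫ c i' ≫ m := by
          rintro _ rfl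
          simp
        refine (key _ (e.symm_apply_apply i)).trans ?_
        rw [← hm (e i)]
        rfl)
  obtain ⟨⟨j, g⟩, hg, hu⟩ := hT _ P _ hc' f
  refine ⟨⟨e.symm j, g⟩, hg, ?_⟩
  rintro ⟨i, g'⟩ h'
  obtain ⟨j', rfl⟩ := e.symm.surjective i
  cases hu ⟨j', g'⟩ h'
  rfl

theorem exists_factor {I : Type v} [Small.{w} I] {X : I → E} {P : E} {c : ∀ i, X i ⟶ P}
    (hc : IsColimit (Cofan.mk P c)) (f : T ⟶ P) : ∃ (i : I) (g : T ⟶ X i), g ≫ c i = f := by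
  obtain ⟨⟨i, g⟩, h, -⟩ := hT.existsUnique_of_small hc f
  exact ⟨i, g, h⟩

theorem index_unique {I : Type v} [Small.{w} I] {X : I → E} {P : E} {c : ∀ i, X i ⟶ P}
    (hc : IsColimit (Cofan.mk P c)) {i j : I} {f : T ⟶ X i} {g : T ⟶ X j}
    (h : f ≫ c i = g ≫ c j) : i = j :=
  congrArg Sigma.fst ((hT.existsUnique_of_small hc (g ≫ c j)).unique
    (y₁ := ⟨i, f⟩) (y₂ := ⟨j, g⟩) h rfl)

theorem hom_unique {I : Type v} [Small.{w} I] {X : I → E} {P : E} {c : ∀ i, X i ⟶ P}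
    (hc : IsColimit (Cofan.mk P c)) {i : I} {f g : T ⟶ X i} (h : f ≫ c i = g ≫ c i) : f = g := by
  cases (hT.existsUnique_of_small hc (g ≫ c i)).unique (y₁ := ⟨i, f⟩) (y₂ := ⟨i, g⟩) h rfl
  rfl

end IsConnectedObj

/-- The two legs of a binary coproduct, as a cofan indexed by the booleans. -/
theorem IsCoproduct.isColimit_cofan {A B X : E} {m : A ⟶ X} {n : B ⟶ X} (h : IsCoproduct m n) :
    Nonempty (IsColimit (Cofan.mk (f := fun b : Bool => bif b then A else B) X
      fun b => match b with
        | true => m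
        | false => n)) :=
  ⟨Cofan.IsColimit.mk _ (fun s => (h.exists_desc (s.inj true) (s.inj false)).choose)
    (fun s b => match b with
      | true => (h.exists_desc (s.inj true) (s.inj false)).choose_spec.1
      | false => (h.exists_desc (s.inj true) (s.inj false)).choose_spec.2)
    (fun s _ hm => h.hom_ext
      ((hm true).trans (h.exists_desc (s.inj true) (s.inj false)).choose_spec.1.symm)
      ((hm false).trans (h.exists_desc (s.inj true) (s.inj false)).choose_spec.2.symm))⟩

section Binary

variable {A B X T : E} {m : A ⟶ X} {n : B ⟶ X} (h : IsCoproduct m n) (hT : IsConnectedObj T)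

include h hT

theorem IsCoproduct.exists_factor (f : T ⟶ X) : (∃ g, g ≫ m = f) ∨ ∃ g, g ≫ n = f := by
  obtain ⟨hc⟩ := h.isColimit_cofan
  obtain ⟨_ | _, g, hg⟩ := hT.exists_factor hc f
  · exact Or.inr ⟨g, hg⟩
  · exact Or.inl ⟨g, hg⟩

theorem IsCoproduct.factor_disjoint {f : T ⟶ A} {g : T ⟶ B} : f ≫ m ≠ g ≫ n := by
  intro e
  obtain ⟨hc⟩ := h.isColimit_cofan
  cases hT.index_unique hc (i := true) (j := false) (f := f) (g := g) e

theorem IsCoproduct.factor_unique {f g : T ⟶ A} (e : f ≫ m = g ≫ m) : f = g := by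
  obtain ⟨hc⟩ := h.isColimit_cofan
  exact hT.hom_unique hc (i := true) e

end Binary

namespace HasConnectedDecompositions

variable (hE : HasConnectedDecompositions E) {Y Z : E}

include hE

theorem hom_ext {f g : Z ⟶ Y} (h : ∀ ⦃T : E⦄, IsConnectedObj T → ∀ t : T ⟶ Z, t ≫ f = t ≫ g) :
    f = g := by
  obtain ⟨I, K, k, hK, ⟨hc⟩⟩ := hE Z
  exact Cofan.IsColimit.hom_ext hc _ _ fun i => h (hK i) (k i)

theorem mono {f : Z ⟶ Y} (h : ∀ ⦃T : E⦄, IsConnectedObj T → ∀ s t : T ⟶ Z, s ≫ f = t ≫ f → s = t) :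
    Mono f :=
  ⟨fun s t e => hE.hom_ext fun _ hT x => h hT _ _ (by rw [Category.assoc, e, Category.assoc])⟩

theorem exists_lift {W : E} (j : W ⟶ Y) (t : Z ⟶ Y)
    (h : ∀ ⦃T : E⦄, IsConnectedObj T → ∀ x : T ⟶ Z, ∃ y, y ≫ j = x ≫ t) : ∃ l, l ≫ j = t := by
  obtain ⟨I, K, k, hK, ⟨hc⟩⟩ := hE Z
  choose y hy using fun i => h (hK i) (k i)
  refine ⟨Cofan.IsColimit.desc hc y, Cofan.IsColimit.hom_ext hc _ _ fun i => ?_⟩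
  rw [Cofan.IsColimit.fac_assoc hc, hy]
  rfl

theorem isIso {f : Z ⟶ Y} (h : ∀ ⦃T : E⦄, IsConnectedObj T → ∀ y : T ⟶ Y, ∃! x, x ≫ f = y) :
    IsIso f := by
  have := hE.mono (f := f) fun _ hT s t e => (h hT _).unique e rfl
  obtain ⟨l, hl⟩ := hE.exists_lift f (𝟙 Y) fun _ hT x => by
    rw [Category.comp_id]
    exact (h hT x).exists
  exact ⟨l, by rw [← cancel_mono f, Category.assoc, hl, Category.comp_id, Category.id_comp], hl⟩

/-- The hypotheses say that the connected elements of `Z` are the disjoint union of those of `A` and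
`B`. In particular each connected component of `Z` lies in `A` or in `B`, so a map out of `Z` can be
glued from maps out of `A` and `B`. -/
theorem isCoproduct {A B : E} {m : A ⟶ Z} {n : B ⟶ Z}
    (h1 : ∀ ⦃T : E⦄, IsConnectedObj T → ∀ z : T ⟶ Z, (∃ x, x ≫ m = z) ∨ ∃ x, x ≫ n = z)
    (h2 : ∀ ⦃T : E⦄, IsConnectedObj T → ∀ (x : T ⟶ A) (y : T ⟶ B), x ≫ m ≠ y ≫ n)
    (hm : ∀ ⦃T : E⦄, IsConnectedObj T → ∀ x y : T ⟶ A, x ≫ m = y ≫ m → x = y)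
    (hn : ∀ ⦃T : E⦄, IsConnectedObj T → ∀ x y : T ⟶ B, x ≫ n = y ≫ n → x = y) :
    IsCoproduct m n := by
  obtain ⟨I, K, k, hK, ⟨hc⟩⟩ := hE Z
  have hI : ∀ ⦃T : E⦄, IsConnectedObj T → ∀ x : T ⟶ Z, ∃ i y, y ≫ k i = x :=
    fun _ hT x => hT.exists_factor hc x
  refine IsCoproduct.mk' (fun {S} f g => ?_) (fun f g e1 e2 => hE.hom_ext fun T hT t => ?_)
  -- Both implications are recorded for every component, so that the glued map has one description
  -- whichever side the component lies on.
  · have hp : ∀ i, ∃ p : K i ⟶ S, (∀ x, x ≫ m = k i → x ≫ f = p) ∧ ∀ x, x ≫ n = k i → x ≫ g = p := by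
      intro i
      rcases h1 (hK i) (k i) with ⟨x, hx⟩ | ⟨x, hx⟩
      · exact ⟨x ≫ f, fun y hy => by rw [hm (hK i) _ _ (hy.trans hx.symm)],
          fun y hy => (h2 (hK i) _ _ (hx.trans hy.symm)).elim⟩
      · exact ⟨x ≫ g, fun y hy => (h2 (hK i) _ _ (hy.trans hx.symm)).elim,
          fun y hy => by rw [hn (hK i) _ _ (hy.trans hx.symm)]⟩
    choose p hp1 hp2 using hp
    have hd : ∀ i, k i ≫ Cofan.IsColimit.desc hc p = p i := Cofan.IsColimit.fac hc p
    refine ⟨Cofan.IsColimit.desc hc p, hE.hom_ext fun T hT t => ?_, hE.hom_ext fun T hT t => ?_⟩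
    · obtain ⟨i, y, hy⟩ := hI hT (t ≫ m)
      rw [← Category.assoc, ← hy, Category.assoc, hd]
      rcases h1 (hK i) (k i) with ⟨x, hx⟩ | ⟨x, hx⟩
      · rw [← hp1 i x hx, ← Category.assoc]
        congr 1
        exact hm hT _ _ (by rw [Category.assoc, hx, hy])
      · exact (h2 hT t (y ≫ x) (by rw [Category.assoc, hx, hy])).elim
    · obtain ⟨i, y, hy⟩ := hI hT (t ≫ n)
      rw [← Category.assoc, ← hy, Category.assoc, hd]
      rcases h1 (hK i) (k i) with ⟨x, hx⟩ | ⟨x, hx⟩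
      · exact (h2 hT (y ≫ x) t (by rw [Category.assoc, hx, hy])).elim
      · rw [← hp2 i x hx, ← Category.assoc]
        congr 1
        exact hn hT _ _ (by rw [Category.assoc, hx, hy])
  · rcases h1 hT t with ⟨x, rfl⟩ | ⟨x, rfl⟩
    · rw [Category.assoc, e1, Category.assoc]
    · rw [Category.assoc, e2, Category.assoc]

/-- The subobject of `Z` whose connected elements are those satisfying a predicate that is
invariant under reparametrization. -/
theorem exists_subobject [HasCoproducts.{w} E] (p : ∀ ⦃T : E⦄, IsConnectedObj T → (T ⟶ Z) → Prop)
    (hp : ∀ ⦃T T' : E⦄ (hT : IsConnectedObj T) (hT' : IsConnectedObj T') (s : T' ⟶ T) (x : T ⟶ Z),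
      p hT' (s ≫ x) ↔ p hT x) :
    ∃ (W : E) (j : W ⟶ Z), Mono j ∧
      ∀ ⦃T : E⦄ (hT : IsConnectedObj T) (x : T ⟶ Z), (∃ y, y ≫ j = x) ↔ p hT x := by
  obtain ⟨I, K, k, hK, ⟨hc⟩⟩ := hE Z
  -- By invariance, whether an element satisfies the predicate depends only on the component
  -- containing it; the subobject is the coproduct of the selected components.
  let I' := {i : I // p (hK i) (k i)}
  let j : (∐ fun i : I' => K i.1) ⟶ Z := Sigma.desc fun i => k i.1
  have hj : ∀ i : I', Sigma.ι (fun i : I' => K i.1) i ≫ j = k i.1 :=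
    fun i => Sigma.ι_desc _ _
  have hι : IsColimit (Cofan.mk (∐ fun i : I' => K i.1) (Sigma.ι fun i : I' => K i.1)) :=
    coproductIsCoproduct _
  refine ⟨_, j, hE.mono fun T hT s t e => ?_, fun T hT x => ⟨?_, fun hx => ?_⟩⟩
  · obtain ⟨i, y, rfl⟩ := hT.exists_factor hι s
    obtain ⟨i', y', rfl⟩ := hT.exists_factor hι t
    rw [Category.assoc, Category.assoc, hj, hj] at e
    obtain rfl := Subtype.ext (hT.index_unique hc e)
    rw [hT.hom_unique hc e]
  · rintro ⟨y, rfl⟩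
    obtain ⟨i, z, rfl⟩ := hT.exists_factor hι y
    rw [Category.assoc, hj, hp (hK i.1)]
    exact i.2
  · obtain ⟨i, y, rfl⟩ := hT.exists_factor hc x
    rw [hp (hK i)] at hx
    exact ⟨y ≫ Sigma.ι (fun i : I' => K i.1) ⟨i, hx⟩, by rw [Category.assoc, hj]⟩

end HasConnectedDecompositions

end ConnectedDetection

/-! ### Summands and ultrafilters of a coproduct -/

section Restriction

variable {C : Type u} [Category.{w} C] [FinitaryExtensive C]

namespace Summand

variable {A X : C}

/-- `Uᶜ` is the class of a complementary leg, and its representing arrow agrees with that leg only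
up to isomorphism. -/
theorem isCoproduct_arrow_compl (U : Summand X) : IsCoproduct U.arrow Uᶜ.arrow := by
  obtain ⟨B, n, h⟩ := U.arrow_isCoprojection
  have e : Uᶜ = mk n h.right := by
    conv_lhs => rw [← U.mk_arrow]
    exact compl_mk h
  obtain ⟨a, ha⟩ := mk_le_mk.1 (Uᶜ.mk_arrow.trans e).le
  obtain ⟨b, hb⟩ := mk_le_mk.1 (Uᶜ.mk_arrow.trans e).ge
  have := h.right.mono
  have := Uᶜ.arrow_isCoprojection.mono
  have h' := (h.symm.iso_left ⟨a, b,
    by rw [← cancel_mono Uᶜ.arrow, Category.assoc, hb, ha, Category.id_comp],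
    by rw [← cancel_mono n, Category.assoc, ha, hb, Category.id_comp]⟩).symm
  dsimp only at h'
  rwa [ha] at h'

theorem preimage_image_self {m : A ⟶ X} (hm : IsCoprojection m) (W : Summand A) :
    preimage m (image m hm W) = W := by
  have := hm.mono
  rw [preimage_image hm (IsKernelPair.id_of_mono m), image_id, preimage_id]

theorem image_preimage {m : A ⟶ X} (hm : IsCoprojection m) (V : Summand X) :
    image m hm (preimage m V) = mk m hm ⊓ V := by
  refine ext_le fun t ht => ?_
  have := V.arrow_isCoprojection.hasPullback m
  have hp := V.arrow_isCoprojection.pullback_fst m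
  obtain ⟨a, ha⟩ := le_preimage.1 (preimage m V).mk_arrow.le
  obtain ⟨b, hb⟩ := (mk_le_iff (hm := hp)).1 (le_refl (preimage m V))
  rw [le_image, mk_le_inf, mk_le_mk, mk_le_iff]
  constructor
  · rintro ⟨k, rfl⟩
    exact ⟨⟨k ≫ (preimage m V).arrow, Category.assoc _ _ _⟩,
      ⟨k ≫ a, by rw [Category.assoc, ha]⟩⟩
  · rintro ⟨⟨k, rfl⟩, ⟨l, hl⟩⟩
    exact ⟨pullback.lift k l hl.symm ≫ b, by
      rw [Category.assoc, reassoc_of% hb, pullback.lift_fst_assoc]⟩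

theorem image_top {m : A ⟶ X} (hm : IsCoprojection m) : image m hm ⊤ = mk m hm := by
  rw [← preimage_top m, image_preimage, inf_top_eq]

/-- The map `X ⟶ X ⨿ X` that is the first coprojection on `U` and the second one on `Uᶜ`. -/
noncomputable def indicator (U : Summand X) : X ⟶ X ⨿ X :=
  (U.isCoproduct_arrow_compl.exists_desc (U.arrow ≫ coprod.inl) (Uᶜ.arrow ≫ coprod.inr)).choose

theorem isCoproduct_inl_inr (X Y : C) :
    IsCoproduct (coprod.inl : X ⟶ X ⨿ Y) (coprod.inr : Y ⟶ X ⨿ Y) :=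
  ⟨coprodIsCoprod X Y⟩

theorem preimage_indicator (U : Summand X) :
    preimage U.indicator (mk coprod.inl (isCoproduct_inl_inr X X).left) = U := by
  obtain ⟨h1, h2⟩ := (U.isCoproduct_arrow_compl.exists_desc (U.arrow ≫ coprod.inl)
    (Uᶜ.arrow ≫ coprod.inr)).choose_spec
  apply le_antisymm
  · rw [← compl_le_compl_iff_le, ← preimage_compl, compl_mk (isCoproduct_inl_inr X X)]
    conv_lhs => rw [← Uᶜ.mk_arrow]
    exact le_preimage_mk.2 ⟨_, h2.symm⟩
  · conv_lhs => rw [← U.mk_arrow]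
    exact le_preimage_mk.2 ⟨_, h1.symm⟩

/-- A summand is recovered from its indicator map, an element of the hom-set `X ⟶ X ⨿ X` in `Type
w`. Hence the ultrafilters on `X` are also essentially `w`-small, and `E` has coproducts indexed by
them. -/
instance : Small.{w} (Summand X) :=
  small_of_injective (f := indicator) fun U V h => by
    rw [← U.preimage_indicator, h, V.preimage_indicator]

end Summand

/-! ### Restriction and pushforward of ultrafilters -/

namespace UltrafilterOn

variable {A X Y Z : C}

instance : Small.{w} (UltrafilterOn X) :=
  small_of_injective (f := UltrafilterOn.carrier) fun _ _ => UltrafilterOn.ext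

theorem mem_def {𝒰 : UltrafilterOn X} {U : Summand X} : U ∈ 𝒰 ↔ U ∈ 𝒰.carrier := Iff.rfl

theorem mem_push {f : X ⟶ Y} {𝒰 : UltrafilterOn X} {V : Summand Y} :
    V ∈ 𝒰.push f ↔ V.preimage f ∈ 𝒰 := Iff.rfl

theorem ext_mem {𝒰 𝒱 : UltrafilterOn X} (h : ∀ U, U ∈ 𝒰 ↔ U ∈ 𝒱) : 𝒰 = 𝒱 :=
  UltrafilterOn.ext (Set.ext h)

theorem compl_mem_iff {𝒰 : UltrafilterOn X} {U : Summand X} : Uᶜ ∈ 𝒰 ↔ U ∉ 𝒰 := by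
  have h := 𝒰.mem_iff_compl_notMem U
  simp only [mem_def]
  tauto

/-- Ultrafilters are maximal: a member of `𝒱` outside `𝒰` would have its complement in `𝒰`, hence in
`𝒱`. Later comparisons of ultrafilters need only one inclusion for this reason. -/
theorem eq_of_le {𝒰 𝒱 : UltrafilterOn X} (h : ∀ U, U ∈ 𝒰 → U ∈ 𝒱) : 𝒰 = 𝒱 :=
  ext_mem fun U => ⟨h U, fun hU => by
    by_contra hn
    exact compl_mem_iff.1 (h _ (compl_mem_iff.2 hn)) hU⟩

theorem push_id (𝒰 : UltrafilterOn X) : 𝒰.push (𝟙 X) = 𝒰 :=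
  ext_mem fun U => by rw [mem_push, Summand.preimage_id]

theorem push_comp (𝒰 : UltrafilterOn X) (f : X ⟶ Y) (g : Y ⟶ Z) :
    𝒰.push (f ≫ g) = (𝒰.push f).push g :=
  ext_mem fun U => by rw [mem_push, Summand.preimage_comp]; rfl

theorem image_preimage_mem_iff {𝒰 : UltrafilterOn X} {m : A ⟶ X} {hm : IsCoprojection m}
    (h : Summand.mk m hm ∈ 𝒰) {V : Summand X} :
    Summand.image m hm (V.preimage m) ∈ 𝒰 ↔ V ∈ 𝒰 := by
  rw [Summand.image_preimage]
  exact (𝒰.inf_mem_iff _ _).trans (and_iff_right h)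

/-- The restriction of an ultrafilter to one of its members. -/
noncomputable def restrict (𝒰 : UltrafilterOn X) (m : A ⟶ X) (hm : IsCoprojection m)
    (h : Summand.mk m hm ∈ 𝒰) : UltrafilterOn A where
  carrier := {W | Summand.image m hm W ∈ 𝒰}
  top_mem := by
    change Summand.image m hm ⊤ ∈ 𝒰
    rwa [Summand.image_top]
  inf_mem_iff U V := by
    change Summand.image m hm (U ⊓ V) ∈ 𝒰 ↔
      Summand.image m hm U ∈ 𝒰 ∧ Summand.image m hm V ∈ 𝒰
    rw [← Summand.preimage_image_self hm U, ← Summand.preimage_image_self hm V,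
      ← Summand.preimage_inf, image_preimage_mem_iff h, image_preimage_mem_iff h,
      image_preimage_mem_iff h]
    exact 𝒰.inf_mem_iff _ _
  mem_iff_compl_notMem U := by
    change Summand.image m hm U ∈ 𝒰 ↔ ¬ Summand.image m hm Uᶜ ∈ 𝒰
    rw [← Summand.preimage_image_self hm U, ← Summand.preimage_compl, image_preimage_mem_iff h,
      image_preimage_mem_iff h]
    exact 𝒰.mem_iff_compl_notMem _

theorem push_restrict (𝒰 : UltrafilterOn X) (m : A ⟶ X) (hm : IsCoprojection m)
    (h : Summand.mk m hm ∈ 𝒰) : (𝒰.restrict m hm h).push m = 𝒰 :=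
  ext_mem fun _ => image_preimage_mem_iff h

theorem mem_iff_image_mem_push {𝒱 : UltrafilterOn A} {m : A ⟶ X} (hm : IsCoprojection m)
    {W : Summand A} : W ∈ 𝒱 ↔ Summand.image m hm W ∈ 𝒱.push m := by
  rw [mem_push, Summand.preimage_image_self]

theorem push_injective {m : A ⟶ X} (hm : IsCoprojection m) :
    Function.Injective (UltrafilterOn.push m) := fun 𝒰 𝒱 h =>
  ext_mem fun W => by rw [mem_iff_image_mem_push hm, h, ← mem_iff_image_mem_push hm]

theorem mk_mem_push (𝒱 : UltrafilterOn A) {m : A ⟶ X} (hm : IsCoprojection m) :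
    Summand.mk m hm ∈ 𝒱.push m := by
  rw [← Summand.image_top hm, ← mem_iff_image_mem_push]
  exact 𝒱.top_mem

theorem mk_mem_or_mk_mem (𝒰 : UltrafilterOn X) {B : C} {m : A ⟶ X} {n : B ⟶ X}
    (h : IsCoproduct m n) : Summand.mk m h.left ∈ 𝒰 ∨ Summand.mk n h.right ∈ 𝒰 := by
  rw [← Summand.compl_mk h, compl_mem_iff]
  exact em _

theorem not_mk_mem_and_mk_mem (𝒰 : UltrafilterOn X) {B : C} {m : A ⟶ X} {n : B ⟶ X}
    (h : IsCoproduct m n) : ¬ (Summand.mk m h.left ∈ 𝒰 ∧ Summand.mk n h.right ∈ 𝒰) := by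
  rw [← Summand.compl_mk h, compl_mem_iff]
  exact and_not_self

instance isEmpty_initial : IsEmpty (UltrafilterOn (⊥_ C)) :=
  ⟨fun 𝒰 => by
    have h : (⊥ : Summand (⊥_ C)) = ⊤ :=
      top_le_iff.1 (Summand.mk_le_mk.2 ⟨𝟙 _, Subsingleton.elim _ _⟩)
    have h1 : (⊤ : Summand (⊥_ C)) ∈ 𝒰 := 𝒰.top_mem
    exact compl_mem_iff.1 (by rwa [compl_bot]) (h ▸ h1)⟩

end UltrafilterOn

/-! ### Total maps and isomorphisms in `UF C` -/

namespace UF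

variable {P Q R : UF C}

/-- The morphism of `UF C` represented by a totally defined map. -/
noncomputable def total (f : P.obj ⟶ Q.obj) (hf : P.uf.push f = Q.uf) : P ⟶ Q :=
  (PartialMap.ofTotal f fun _ => by rw [← hf]; rfl).toHom

theorem total_id (h : P.uf.push (𝟙 P.obj) = P.uf) : total (𝟙 P.obj) h = 𝟙 P := rfl

theorem total_comp (f : P.obj ⟶ Q.obj) (hf : P.uf.push f = Q.uf) (g : Q.obj ⟶ R.obj)
    (hg : Q.uf.push g = R.uf) (h : P.uf.push (f ≫ g) = R.uf) :
    total (f ≫ g) h = total f hf ≫ total g hg := by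
  refine (Quotient.sound ?_).symm
  obtain ⟨a, b, h, h1, h2⟩ := PartialMap.exists_proj_comp
    (PartialMap.ofTotal (P := P) (Q := Q) f fun _ => by rw [← hf]; rfl)
    (PartialMap.ofTotal (P := Q) (Q := R) g fun _ => by rw [← hg]; rfl)
  refine PartialMap.equivalent_of_factors a h1.symm ?_
  rw [h2]
  exact (Category.assoc a f g).symm.trans (congrArg (· ≫ g) (h.trans (Category.comp_id b)))

/-- The inverse is the partial map defined on `m` itself whose underlying map is the identity. -/
theorem isIso_total (m : P.obj ⟶ Q.obj) (hm : IsCoprojection m) (h : P.uf.push m = Q.uf) :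
    IsIso (total m h) := by
  have := hm.mono
  let r : PartialMap Q P :=
    { dom := P.obj
      incl := m
      isCoprojection := hm
      mem := by
        rw [← h]
        exact P.uf.mk_mem_push hm
      map := 𝟙 _
      continuous := fun V => by
        rw [Summand.preimage_id, ← h]
        exact UltrafilterOn.mem_iff_image_mem_push hm }
  refine ⟨r.toHom, Quotient.sound ?_, Quotient.sound ?_⟩
  · obtain ⟨a, b, h0, h1, h2⟩ := PartialMap.exists_proj_comp
      (PartialMap.ofTotal (P := P) (Q := Q) m fun _ => by rw [← h]; rfl) r
    refine PartialMap.equivalent_of_factors a h1.symm ?_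
    rw [h2]
    change a ≫ m = b ≫ m at h0
    rw [(cancel_mono m).1 h0]
    rfl
  · obtain ⟨a, b, h0, h1, h2⟩ := PartialMap.exists_proj_comp r
      (PartialMap.ofTotal (P := P) (Q := Q) m fun _ => by rw [← h]; rfl)
    refine PartialMap.equivalent_of_factors (PartialMap.comp r _).incl (Category.comp_id _) ?_
    rw [h1, h2]
    change a ≫ 𝟙 _ = b ≫ 𝟙 _ at h0
    change (a ≫ m) ≫ 𝟙 _ = b ≫ m
    rw [Category.comp_id, (cancel_mono (𝟙 _)).1 h0]
    rfl

end UF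

namespace PartialMap

variable {P Q : UF C} (f : PartialMap P Q)

/-- The domain of a partial map, with the restricted ultrafilter. -/
noncomputable abbrev domUF : UF C := ⟨f.dom, P.uf.restrict f.incl f.isCoprojection f.mem⟩

theorem push_incl : f.domUF.uf.push f.incl = P.uf := P.uf.push_restrict _ _ f.mem

theorem push_map : f.domUF.uf.push f.map = Q.uf :=
  UltrafilterOn.ext_mem fun V => (f.continuous V).symm

/-- Since the inclusion of the domain is invertible in `UF C`, this presents every morphism as a
total map preceded by the inverse of a total map. -/
theorem total_incl_comp :
    UF.total (P := f.domUF) f.incl f.push_incl ≫ f.toHom =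
      UF.total (P := f.domUF) f.map f.push_map := by
  have := f.isCoprojection.mono
  refine Quotient.sound ?_
  obtain ⟨a, b, h0, h1, h2⟩ := exists_proj_comp
    (PartialMap.ofTotal (P := f.domUF) (Q := P) f.incl fun _ => by rw [← f.push_incl]; rfl) f
  refine PartialMap.equivalent_of_factors a h1.symm ?_
  rw [h2]
  change a ≫ f.incl = b ≫ f.incl at h0
  rw [(cancel_mono f.incl).1 h0]
  rfl

end PartialMap

end Restriction

/-! ### The ultrafilter of a connected element -/

section ElementUltrafilter

theorem IsCoproduct.map {C : Type u} [Category.{v} C] {E : Type u₁} [Category.{w} E] {A B X : C}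
    {m : A ⟶ X} {n : B ⟶ X} (h : IsCoproduct m n) (F : C ⥤ E) [PreservesFiniteCoproducts F] :
    IsCoproduct (F.map m) (F.map n) :=
  h.elim fun h => ⟨mapIsColimitOfPreservesOfIsColimit F _ _ h⟩

theorem HasConnectedDecompositions.mono_map {C : Type u} [Category.{v} C] {E : Type u₁}
    [Category.{w} E] (hE : HasConnectedDecompositions E) (F : C ⥤ E) [PreservesFiniteCoproducts F]
    {A X : C} {m : A ⟶ X} (hm : IsCoprojection m) : Mono (F.map m) := by
  obtain ⟨B, n, h⟩ := hm
  exact hE.mono fun _ hT _ _ e => (h.map F).factor_unique hT e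

variable {C : Type u} [Category.{w} C] [FinitaryExtensive C] {E : Type u₁} [Category.{w} E]

section

variable (F : C ⥤ E) [PreservesFiniteCoproducts F] {T : E} (hT : IsConnectedObj T) {X Y : C}

include hT

/-- An element of `F X` over a connected object lies in exactly one of two complementary
summands. -/
theorem exists_factor_compl_iff (x : T ⟶ F.obj X) (U : Summand X) :
    (∃ y, y ≫ F.map Uᶜ.arrow = x) ↔ ¬ ∃ y, y ≫ F.map U.arrow = x := by
  have h := U.isCoproduct_arrow_compl.map F
  constructor
  · rintro ⟨y, hy⟩ ⟨z, hz⟩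
    exact h.factor_disjoint hT (hz.trans hy.symm)
  · exact fun h' => (h.exists_factor hT x).resolve_left h'

/-- One direction is the commuting pullback square. The other is that direction applied to `Vᶜ`: an
element outside `F (f⁻¹ V)` lies in `F (f⁻¹ Vᶜ)`, so its image lies in `F Vᶜ` and not in `F V`.
Preservation of pullbacks by `F` is not needed. -/
theorem exists_factor_preimage_iff (f : X ⟶ Y) (x : T ⟶ F.obj X) (V : Summand Y) :
    (∃ y, y ≫ F.map (V.preimage f).arrow = x) ↔ ∃ y, y ≫ F.map V.arrow = x ≫ F.map f := by
  have key : ∀ W : Summand Y, (∃ y, y ≫ F.map (W.preimage f).arrow = x) →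
      ∃ y, y ≫ F.map W.arrow = x ≫ F.map f := by
    rintro W ⟨y, rfl⟩
    obtain ⟨k, hk⟩ := Summand.le_preimage.1 (W.preimage f).mk_arrow.le
    exact ⟨y ≫ F.map k, by rw [Category.assoc, ← F.map_comp, hk, F.map_comp, Category.assoc]⟩
  refine ⟨key V, fun h => ?_⟩
  by_contra hn
  rw [← exists_factor_compl_iff F hT, ← Summand.preimage_compl] at hn
  exact (exists_factor_compl_iff F hT _ V).1 (key _ hn) h

end

variable (F F' : C ⥤ E) [PreservesFiniteCoproducts F] [PreservesFiniteCoproducts F'] {T T' : E}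
  (hT : IsConnectedObj T) (hT' : IsConnectedObj T') {X Y : C}

/-- The ultrafilter of all summands `U` such that a given element `x` of `F X` over a connected
object lies in `F U`. -/
def elementUltrafilter (x : T ⟶ F.obj X) : UltrafilterOn X where
  carrier := {U | ∃ y, y ≫ F.map U.arrow = x}
  top_mem := by
    obtain ⟨k, hk⟩ := Summand.mk_le_iff.1
      (le_refl (⊤ : Summand X) : Summand.mk (𝟙 X) (isCoproduct_id X).left ≤ _)
    exact ⟨x ≫ F.map k, by rw [Category.assoc, ← F.map_comp, hk, F.map_id, Category.comp_id]⟩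
  inf_mem_iff U V := by
    have mono : ∀ U V : Summand X, U ≤ V → (∃ y, y ≫ F.map U.arrow = x) →
        ∃ y, y ≫ F.map V.arrow = x := by
      rintro U V h ⟨y, rfl⟩
      obtain ⟨k, hk⟩ := Summand.mk_le_iff.1 (U.mk_arrow.le.trans h)
      exact ⟨y ≫ F.map k, by rw [Category.assoc, ← F.map_comp, hk]⟩
    refine ⟨fun h => ⟨mono _ _ inf_le_left h, mono _ _ inf_le_right h⟩, ?_⟩
    rintro ⟨⟨y, rfl⟩, hV⟩
    obtain ⟨z, rfl⟩ := (exists_factor_preimage_iff F hT U.arrow y V).2 hV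
    -- The meet is by definition the image under `U.arrow` of the preimage of `V`, so reflexivity
    -- supplies the comparison map.
    obtain ⟨k, hk⟩ : ∃ k, k ≫ (U ⊓ V).arrow = (V.preimage U.arrow).arrow ≫ U.arrow :=
      (Summand.mk_le_iff (hm := (V.preimage U.arrow).arrow_isCoprojection.comp
        U.arrow_isCoprojection)).1 (le_refl (U ⊓ V))
    exact ⟨z ≫ F.map k, by rw [Category.assoc, ← F.map_comp, hk, F.map_comp, Category.assoc]⟩
  mem_iff_compl_notMem U := by
    refine Iff.trans ?_ (not_congr (exists_factor_compl_iff F hT x U)).symm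
    exact not_not.symm

theorem mem_elementUltrafilter {x : T ⟶ F.obj X} {U : Summand X} :
    U ∈ elementUltrafilter F hT x ↔ ∃ y, y ≫ F.map U.arrow = x := Iff.rfl

theorem mk_mem_elementUltrafilter {x : T ⟶ F.obj X} {A : C} {m : A ⟶ X} (hm : IsCoprojection m) :
    Summand.mk m hm ∈ elementUltrafilter F hT x ↔ ∃ y, y ≫ F.map m = x := by
  obtain ⟨a, ha⟩ := Summand.mk_le_mk.1 (Summand.mk m hm).mk_arrow.le
  obtain ⟨b, hb⟩ := Summand.mk_le_mk.1 (Summand.mk m hm).mk_arrow.ge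
  rw [mem_elementUltrafilter]
  constructor
  · rintro ⟨y, rfl⟩
    exact ⟨y ≫ F.map a, by rw [Category.assoc, ← F.map_comp, ha]⟩
  · rintro ⟨y, rfl⟩
    exact ⟨y ≫ F.map b, by rw [Category.assoc, ← F.map_comp, hb]⟩

theorem elementUltrafilter_comp_map (x : T ⟶ F.obj X) (f : X ⟶ Y) :
    elementUltrafilter F hT (x ≫ F.map f) = (elementUltrafilter F hT x).push f :=
  UltrafilterOn.ext_mem fun V => (exists_factor_preimage_iff F hT f x V).symm

theorem elementUltrafilter_precomp (s : T' ⟶ T) (x : T ⟶ F.obj X) :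
    elementUltrafilter F hT' (s ≫ x) = elementUltrafilter F hT x := by
  refine (UltrafilterOn.eq_of_le fun U => ?_).symm
  rintro ⟨y, rfl⟩
  exact ⟨s ≫ y, Category.assoc _ _ _⟩

theorem elementUltrafilter_comp_app (x : T ⟶ F.obj X) (α : F ⟶ F') :
    elementUltrafilter F' hT (x ≫ α.app X) = elementUltrafilter F hT x := by
  refine (UltrafilterOn.eq_of_le fun U => ?_).symm
  rintro ⟨y, rfl⟩
  exact ⟨y ≫ α.app _, by rw [Category.assoc, Category.assoc, α.naturality]⟩

end ElementUltrafilter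

/-! ### Intersections of the images of the members of an ultrafilter -/

section Stalk

variable {C : Type u} [Category.{w} C] [FinitaryExtensive C] {E : Type u₁} [Category.{w} E]

/-- `j : S ⟶ F X` is the subobject of elements with ultrafilter `𝒰`. -/
structure IsStalk (F : C ⥤ E) [PreservesFiniteCoproducts F] (P : UF C) {S : E}
    (j : S ⟶ F.obj P.obj) : Prop where
  mono : Mono j
  factors_iff : ∀ ⦃T : E⦄ (hT : IsConnectedObj T) (x : T ⟶ F.obj P.obj),
    (∃ y, y ≫ j = x) ↔ elementUltrafilter F hT x = P.uf

theorem IsStalk.elementUltrafilter_eq {F : C ⥤ E} [PreservesFiniteCoproducts F] {P : UF C} {S : E}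
    {j : S ⟶ F.obj P.obj} (h : IsStalk F P j) {T : E} (hT : IsConnectedObj T) (y : T ⟶ S) :
    elementUltrafilter F hT (y ≫ j) = P.uf :=
  (h.factors_iff hT _).1 ⟨y, rfl⟩

namespace HasConnectedDecompositions

variable (hE : HasConnectedDecompositions E)

include hE

/-- The ultrafilter of an element does not change under reparametrization, so it is a legitimate
predicate for cutting out a subobject. -/
theorem exists_isStalk [HasCoproducts.{w} E] (F : C ⥤ E) [PreservesFiniteCoproducts F] (P : UF C) :
    ∃ (S : E) (j : S ⟶ F.obj P.obj), IsStalk F P j := by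
  obtain ⟨S, j, h1, h2⟩ := hE.exists_subobject (Z := F.obj P.obj)
    (fun _ hT x => elementUltrafilter F hT x = P.uf)
    (fun _ _ hT hT' s x => by rw [elementUltrafilter_precomp F hT hT'])
  exact ⟨S, j, h1, h2⟩

variable {F : C ⥤ E} [PreservesFiniteCoproducts F] {P Q : UF C} {S S' : E}
  {j : S ⟶ F.obj P.obj} {j' : S' ⟶ F.obj Q.obj}

/-- An element lying in `F U` for every `U` in the ultrafilter of `P` has an ultrafilter containing
that one, hence equal to it by maximality. -/
theorem isIntersection (h : IsStalk F P j) :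
    IsIntersection (fun U : {U : Summand P.obj // U ∈ P.uf} => F.map U.1.arrow) j where
  mono_family U := hE.mono_map F U.1.arrow_isCoprojection
  mono := h.mono
  factors_iff t := by
    constructor
    · rintro ⟨l, rfl⟩ U
      refine hE.exists_lift _ _ fun T hT x => ?_
      have e := h.elementUltrafilter_eq hT (x ≫ l)
      rw [← mem_elementUltrafilter F hT, ← Category.assoc, e]
      exact U.2
    · intro H
      refine hE.exists_lift _ _ fun T hT x => (h.factors_iff hT _).2 ?_
      refine (UltrafilterOn.eq_of_le fun U hU => ?_).symm
      obtain ⟨k, hk⟩ := H ⟨U, hU⟩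
      exact ⟨x ≫ k, by rw [Category.assoc, hk]⟩

theorem exists_lift_dom (h : IsStalk F P j) (f : PartialMap P Q) :
    ∃ l, l ≫ F.map f.incl = j := by
  refine hE.exists_lift _ _ fun T hT x => ?_
  rw [← mk_mem_elementUltrafilter F hT f.isCoprojection, h.elementUltrafilter_eq]
  exact f.mem

/-- The action of a morphism of `UF C` on the stalks of `F`. -/
theorem exists_stalk_map (h : IsStalk F P j) (h' : IsStalk F Q j') (q : P ⟶ Q) :
    ∃ r : S ⟶ S', ∀ (f : PartialMap P Q) (l : S ⟶ F.obj f.dom), f.toHom = q →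
      l ≫ F.map f.incl = j → r ≫ j' = l ≫ F.map f.map := by
  obtain ⟨f, rfl⟩ : ∃ f : PartialMap P Q, f.toHom = q := Quotient.exists_rep q
  obtain ⟨l, hl⟩ := hE.exists_lift_dom h f
  have hm := hE.mono_map F f.isCoprojection
  obtain ⟨r, hr⟩ := hE.exists_lift j' (l ≫ F.map f.map) fun T hT x => by
    rw [h'.factors_iff hT, ← Category.assoc, elementUltrafilter_comp_map, ← f.push_map]
    congr 1
    -- The lifted element should carry the restricted ultrafilter on the domain of `f`; this can be
    -- checked after pushing forward to `P.obj`.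
    apply UltrafilterOn.push_injective f.isCoprojection
    rw [← elementUltrafilter_comp_map, Category.assoc, hl, f.push_incl, h.elementUltrafilter_eq]
  refine ⟨r, fun g l' hg hl' => ?_⟩
  obtain ⟨W, m, hW, a, b, hWm, h1, h2, h3⟩ := Quotient.exact hg
  obtain ⟨k, hk⟩ := hE.exists_lift (F.map m) j fun T hT x => by
    rw [← mk_mem_elementUltrafilter F hT hW, h.elementUltrafilter_eq]
    exact hWm
  have hm' := hE.mono_map F g.isCoprojection
  -- Independence of the representative: the stalk also factors through `F W`, where the two partial
  -- maps agree.
  have e1 : k ≫ F.map b = l := by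
    rw [← cancel_mono (F.map f.incl), Category.assoc, ← F.map_comp, h2, hk, hl]
  have e2 : k ≫ F.map a = l' := by
    rw [← cancel_mono (F.map g.incl), Category.assoc, ← F.map_comp, h1, hk, hl']
  rw [hr, ← e1, ← e2, Category.assoc, Category.assoc, ← F.map_comp, ← F.map_comp, h3]

end HasConnectedDecompositions

end Stalk

/-! ### Functoriality of stalks -/

section StalkFunctor

variable {C : Type u} [Category.{w} C] [FinitaryExtensive C] {E : Type u₁} [Category.{w} E]
  [HasCoproducts.{w} E] (hE : HasConnectedDecompositions E)

/-- The intersection `⋂_{U ∈ 𝒰} F U ⊆ F X`. -/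
noncomputable def stalk (F : C ⥤ E) [PreservesFiniteCoproducts F] (P : UF C) : E :=
  (hE.exists_isStalk F P).choose

/-- The inclusion of the stalk at `(X, 𝒰)` in `F X`. -/
noncomputable def stalkι (F : C ⥤ E) [PreservesFiniteCoproducts F] (P : UF C) :
    stalk hE F P ⟶ F.obj P.obj :=
  (hE.exists_isStalk F P).choose_spec.choose

theorem isStalk_stalkι (F : C ⥤ E) [PreservesFiniteCoproducts F] (P : UF C) :
    IsStalk F P (stalkι hE F P) :=
  (hE.exists_isStalk F P).choose_spec.choose_spec

instance (F : C ⥤ E) [PreservesFiniteCoproducts F] (P : UF C) : Mono (stalkι hE F P) :=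
  (isStalk_stalkι hE F P).mono

/-- The action of a morphism of `UF C` on stalks. -/
noncomputable def stalkMap (F : C ⥤ E) [PreservesFiniteCoproducts F] {P Q : UF C} (q : P ⟶ Q) :
    stalk hE F P ⟶ stalk hE F Q :=
  (hE.exists_stalk_map (isStalk_stalkι hE F P) (isStalk_stalkι hE F Q) q).choose

theorem stalkMap_toHom (F : C ⥤ E) [PreservesFiniteCoproducts F] {P Q : UF C}
    (f : PartialMap P Q) (l : stalk hE F P ⟶ F.obj f.dom) (hl : l ≫ F.map f.incl = stalkι hE F P) :
    stalkMap hE F f.toHom ≫ stalkι hE F Q = l ≫ F.map f.map :=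
  (hE.exists_stalk_map (isStalk_stalkι hE F P) (isStalk_stalkι hE F Q) f.toHom).choose_spec
    f l rfl hl

theorem stalkMap_total (F : C ⥤ E) [PreservesFiniteCoproducts F] {P Q : UF C}
    (f : P.obj ⟶ Q.obj) (hf : P.uf.push f = Q.uf) :
    stalkMap hE F (UF.total f hf) ≫ stalkι hE F Q = stalkι hE F P ≫ F.map f :=
  stalkMap_toHom hE F (PartialMap.ofTotal f _) (stalkι hE F P)
    ((congrArg _ (F.map_id _)).trans (Category.comp_id _))

theorem stalkMap_id (F : C ⥤ E) [PreservesFiniteCoproducts F] (P : UF C) :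
    stalkMap hE F (𝟙 P) = 𝟙 _ := by
  rw [← cancel_mono (stalkι hE F P), ← UF.total_id P.uf.push_id, stalkMap_total, F.map_id,
    Category.comp_id, Category.id_comp]

theorem stalkMap_comp (F : C ⥤ E) [PreservesFiniteCoproducts F] {P Q R : UF C} (p : P ⟶ Q)
    (q : Q ⟶ R) : stalkMap hE F (p ≫ q) = stalkMap hE F p ≫ stalkMap hE F q := by
  obtain ⟨f, rfl⟩ : ∃ f : PartialMap P Q, f.toHom = p := Quotient.exists_rep p
  obtain ⟨g, rfl⟩ : ∃ g : PartialMap Q R, g.toHom = q := Quotient.exists_rep q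
  change stalkMap hE F (f.comp g).toHom = _
  obtain ⟨a, b, h0, h1, h2⟩ := PartialMap.exists_proj_comp f g
  obtain ⟨l, hl⟩ := hE.exists_lift_dom (isStalk_stalkι hE F P) (f.comp g)
  obtain ⟨k, hk⟩ := hE.exists_lift_dom (isStalk_stalkι hE F Q) g
  have := hE.mono_map F g.isCoprojection
  have hf := stalkMap_toHom hE F f (l ≫ F.map a) (by
    rw [Category.assoc, ← F.map_comp, ← h1, hl])
  have e : stalkMap hE F f.toHom ≫ k = l ≫ F.map b := by
    rw [← cancel_mono (F.map g.incl), Category.assoc, hk, hf, Category.assoc, Category.assoc,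
      ← F.map_comp, ← F.map_comp, h0]
  rw [← cancel_mono (stalkι hE F R), stalkMap_toHom hE F _ l hl, Category.assoc,
    stalkMap_toHom hE F g k hk, ← Category.assoc, e, h2, F.map_comp, Category.assoc]

theorem exists_stalk_natTrans {F F' : C ⥤ E} [PreservesFiniteCoproducts F]
    [PreservesFiniteCoproducts F'] (α : F ⟶ F') (P : UF C) :
    ∃ r : stalk hE F P ⟶ stalk hE F' P, r ≫ stalkι hE F' P = stalkι hE F P ≫ α.app P.obj :=
  hE.exists_lift _ _ fun T hT x => by
    rw [(isStalk_stalkι hE F' P).factors_iff hT, ← Category.assoc,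
      elementUltrafilter_comp_app F F' hT, (isStalk_stalkι hE F P).elementUltrafilter_eq]

/-- The restriction of a transformation to stalks. -/
noncomputable def stalkTrans {F F' : C ⥤ E} [PreservesFiniteCoproducts F]
    [PreservesFiniteCoproducts F'] (α : F ⟶ F') (P : UF C) : stalk hE F P ⟶ stalk hE F' P :=
  (exists_stalk_natTrans hE α P).choose

theorem stalkTrans_ι {F F' : C ⥤ E} [PreservesFiniteCoproducts F]
    [PreservesFiniteCoproducts F'] (α : F ⟶ F') (P : UF C) :
    stalkTrans hE α P ≫ stalkι hE F' P = stalkι hE F P ≫ α.app P.obj :=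
  (exists_stalk_natTrans hE α P).choose_spec

theorem stalkTrans_naturality {F F' : C ⥤ E} [PreservesFiniteCoproducts F]
    [PreservesFiniteCoproducts F'] (α : F ⟶ F') {P Q : UF C} (q : P ⟶ Q) :
    stalkMap hE F q ≫ stalkTrans hE α Q = stalkTrans hE α P ≫ stalkMap hE F' q := by
  obtain ⟨f, rfl⟩ : ∃ f : PartialMap P Q, f.toHom = q := Quotient.exists_rep q
  obtain ⟨l, hl⟩ := hE.exists_lift_dom (isStalk_stalkι hE F P) f
  obtain ⟨k, hk⟩ := hE.exists_lift_dom (isStalk_stalkι hE F' P) f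
  have := hE.mono_map F' f.isCoprojection
  have e : stalkTrans hE α P ≫ k = l ≫ α.app _ := by
    rw [← cancel_mono (F'.map f.incl), Category.assoc, hk, stalkTrans_ι, Category.assoc,
      ← α.naturality, ← Category.assoc, hl]
  rw [← cancel_mono (stalkι hE F' Q), Category.assoc, stalkTrans_ι, ← Category.assoc,
    stalkMap_toHom hE F f l hl, Category.assoc, Category.assoc, stalkMap_toHom hE F' f k hk,
    ← Category.assoc (stalkTrans hE α P), e, Category.assoc, α.naturality]

end StalkFunctor

/-! ### Sums over ultrafilters -/

section Sum

variable {C : Type u} [Category.{w} C] [FinitaryExtensive C] {E : Type u₁} [Category.{w} E]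
  [HasCoproducts.{w} E]

instance (X : C) : HasColimitsOfShape (Discrete (UltrafilterOn X)) E :=
  hasCoproductsOfShape_of_small _ _

variable (B : UF C ⥤ E)

/-- The sum of the values of `B` at all ultrafilters on `X`. -/
noncomputable def ultraSum (X : C) : E := ∐ fun 𝒰 : UltrafilterOn X => B.obj ⟨X, 𝒰⟩

/-- The coprojections of `ultraSum`. -/
noncomputable def ultraSumι (P : UF C) : B.obj P ⟶ ultraSum B P.obj :=
  Sigma.ι (fun 𝒰 : UltrafilterOn P.obj => B.obj ⟨P.obj, 𝒰⟩) P.uf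

/-- `ultraSum` is a coproduct. -/
noncomputable def ultraSumIsColimit (X : C) :
    IsColimit (Cofan.mk (ultraSum B X) fun 𝒰 : UltrafilterOn X => ultraSumι B ⟨X, 𝒰⟩) :=
  coproductIsCoproduct _

variable {B}

theorem ultraSum_hom_ext {X : C} {Z : E} {f g : ultraSum B X ⟶ Z}
    (h : ∀ 𝒰 : UltrafilterOn X, ultraSumι B ⟨X, 𝒰⟩ ≫ f = ultraSumι B ⟨X, 𝒰⟩ ≫ g) : f = g :=
  Cofan.IsColimit.hom_ext (ultraSumIsColimit B X) _ _ h

/-- Maps out of `ultraSum`. -/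
noncomputable def ultraSumDesc {X : C} {Z : E} (f : ∀ 𝒰 : UltrafilterOn X, B.obj ⟨X, 𝒰⟩ ⟶ Z) :
    ultraSum B X ⟶ Z :=
  Cofan.IsColimit.desc (ultraSumIsColimit B X) f

theorem ultraSumι_desc {X : C} {Z : E} (f : ∀ 𝒰 : UltrafilterOn X, B.obj ⟨X, 𝒰⟩ ⟶ Z)
    (𝒰 : UltrafilterOn X) : ultraSumι B ⟨X, 𝒰⟩ ≫ ultraSumDesc f = f 𝒰 :=
  Cofan.IsColimit.fac (ultraSumIsColimit B X) f 𝒰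

variable (B) in
/-- The action of a map on `ultraSum`. -/
noncomputable def ultraSumMap {X Y : C} (f : X ⟶ Y) : ultraSum B X ⟶ ultraSum B Y :=
  ultraSumDesc fun 𝒰 => B.map (UF.pushHom f 𝒰) ≫ ultraSumι B ⟨Y, 𝒰.push f⟩

variable (B) in
theorem ultraSumι_map {P Q : UF C} (f : P.obj ⟶ Q.obj) (hf : P.uf.push f = Q.uf) :
    ultraSumι B P ≫ ultraSumMap B f = B.map (UF.total f hf) ≫ ultraSumι B Q := by
  obtain ⟨X, 𝒰⟩ := P
  obtain ⟨Y, 𝒱⟩ := Q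
  change X ⟶ Y at f
  obtain rfl : 𝒰.push f = 𝒱 := hf
  exact ultraSumι_desc _ _

variable (B) in
/-- The functor `∫ B`. -/
noncomputable abbrev ultraSumFunctor : C ⥤ E where
  obj := ultraSum B
  map := ultraSumMap B
  map_id X := ultraSum_hom_ext fun 𝒰 => by
    rw [ultraSumι_map (P := ⟨X, 𝒰⟩) (Q := ⟨X, 𝒰⟩) B (𝟙 X) 𝒰.push_id, UF.total_id, B.map_id,
      Category.id_comp, Category.comp_id]
  map_comp {X Y Z} f g := ultraSum_hom_ext fun 𝒰 => by
    rw [ultraSumι_map (P := ⟨X, 𝒰⟩) (Q := ⟨Z, (𝒰.push f).push g⟩) B (f ≫ g) (𝒰.push_comp f g),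
      UF.total_comp (P := ⟨X, 𝒰⟩) (Q := ⟨Y, 𝒰.push f⟩) (R := ⟨Z, (𝒰.push f).push g⟩)
        f rfl g rfl, B.map_comp, ← Category.assoc,
      ultraSumι_map (P := ⟨X, 𝒰⟩) (Q := ⟨Y, 𝒰.push f⟩) B f rfl, Category.assoc, Category.assoc,
      ultraSumι_map (P := ⟨Y, 𝒰.push f⟩) (Q := ⟨Z, (𝒰.push f).push g⟩) B g rfl]

theorem inv_map_total_ultraSumι_map {P Q : UF C} (m : Q.obj ⟶ P.obj) (h : Q.uf.push m = P.uf)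
    [IsIso (UF.total m h)] :
    inv (B.map (UF.total m h)) ≫ ultraSumι B Q ≫ ultraSumMap B m = ultraSumι B P := by
  rw [ultraSumι_map B m h, IsIso.inv_hom_id_assoc]

/-- Elements of `∫ B` at an ultrafilter containing a summand lift to that summand. -/
theorem exists_factor_ultraSumMap {A : C} {P : UF C} {m : A ⟶ P.obj} (hm : IsCoprojection m)
    (h : Summand.mk m hm ∈ P.uf) {T : E} (y : T ⟶ B.obj P) :
    ∃ z, z ≫ ultraSumMap B m = y ≫ ultraSumι B P := by
  let Q : UF C := ⟨A, P.uf.restrict m hm h⟩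
  have := UF.isIso_total (P := Q) (Q := P) m hm (P.uf.push_restrict m hm h)
  refine ⟨y ≫ inv (B.map (UF.total (P := Q) (Q := P) m (P.uf.push_restrict m hm h))) ≫
    ultraSumι B Q, ?_⟩
  rw [Category.assoc, Category.assoc]
  exact congrArg (y ≫ ·) (inv_map_total_ultraSumι_map (P := P) (Q := Q) m _)

section Elements

variable {T : E} (hT : IsConnectedObj T)

include hT

variable (B) in
theorem exists_factor_ultraSum {X : C} (z : T ⟶ ultraSum B X) :
    ∃ (𝒰 : UltrafilterOn X) (y : T ⟶ B.obj ⟨X, 𝒰⟩), y ≫ ultraSumι B ⟨X, 𝒰⟩ = z :=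
  hT.exists_factor (ultraSumIsColimit B X) z

theorem ultraSum_uf_unique {X : C} {𝒰 𝒱 : UltrafilterOn X} {y : T ⟶ B.obj ⟨X, 𝒰⟩}
    {z : T ⟶ B.obj ⟨X, 𝒱⟩} (h : y ≫ ultraSumι B ⟨X, 𝒰⟩ = z ≫ ultraSumι B ⟨X, 𝒱⟩) : 𝒰 = 𝒱 :=
  hT.index_unique (ultraSumIsColimit B X) h

theorem ultraSum_hom_unique {P : UF C} {y z : T ⟶ B.obj P}
    (h : y ≫ ultraSumι B P = z ≫ ultraSumι B P) : y = z :=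
  hT.hom_unique (ultraSumIsColimit B P.obj) h

/-- Pushing forward along a coprojection is injective on ultrafilters, which settles the index;
within one summand, `B` acts by an isomorphism. -/
theorem ultraSumMap_injective {A X : C} {m : A ⟶ X} (hm : IsCoprojection m)
    {y z : T ⟶ ultraSum B A} (h : y ≫ ultraSumMap B m = z ≫ ultraSumMap B m) : y = z := by
  obtain ⟨𝒰, y, rfl⟩ := exists_factor_ultraSum B hT y
  obtain ⟨𝒱, z, rfl⟩ := exists_factor_ultraSum B hT z
  rw [Category.assoc, Category.assoc,
    ultraSumι_map (P := ⟨A, 𝒰⟩) (Q := ⟨X, 𝒰.push m⟩) B m rfl,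
    ultraSumι_map (P := ⟨A, 𝒱⟩) (Q := ⟨X, 𝒱.push m⟩) B m rfl, ← Category.assoc, ← Category.assoc] at h
  obtain rfl := UltrafilterOn.push_injective hm (ultraSum_uf_unique hT h)
  have := UF.isIso_total (P := ⟨A, 𝒰⟩) (Q := ⟨X, 𝒰.push m⟩) m hm rfl
  have h' := ultraSum_hom_unique hT h
  rw [cancel_mono] at h'
  rw [h']

theorem mk_mem_of_factor_ultraSumMap {A : C} {P : UF C} {m : A ⟶ P.obj} (hm : IsCoprojection m)
    {y : T ⟶ B.obj P} {z : T ⟶ ultraSum B A} (h : z ≫ ultraSumMap B m = y ≫ ultraSumι B P) :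
    Summand.mk m hm ∈ P.uf := by
  obtain ⟨X, 𝒱⟩ := P
  change A ⟶ X at m
  obtain ⟨𝒰, z, rfl⟩ := exists_factor_ultraSum B hT z
  rw [Category.assoc, ultraSumι_map (P := ⟨A, 𝒰⟩) (Q := ⟨X, 𝒰.push m⟩) B m rfl,
    ← Category.assoc] at h
  obtain rfl : 𝒰.push m = 𝒱 := ultraSum_uf_unique hT h
  exact 𝒰.mk_mem_push hm

end Elements

variable (hE : HasConnectedDecompositions E)

include hE

variable (B) in
theorem mono_ultraSumι (P : UF C) : Mono (ultraSumι B P) :=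
  hE.mono fun _ hT _ _ h => ultraSum_hom_unique hT h

variable (B) in
-- An element at `𝒰` comes from `A` exactly when the summand `m` belongs to `𝒰`, and from `A'`
-- exactly when `n` does; `𝒰` contains exactly one of the two.
theorem isCoproduct_ultraSumMap {A A' X : C} {m : A ⟶ X} {n : A' ⟶ X} (h : IsCoproduct m n) :
    IsCoproduct (ultraSumMap B m) (ultraSumMap B n) := by
  refine hE.isCoproduct (fun T hT z => ?_) (fun T hT y z e => ?_)
    (fun T hT _ _ => ultraSumMap_injective hT h.left)
    (fun T hT _ _ => ultraSumMap_injective hT h.right)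
  · obtain ⟨𝒰, y, rfl⟩ := exists_factor_ultraSum B hT z
    exact (𝒰.mk_mem_or_mk_mem h).imp
      (fun hm => exists_factor_ultraSumMap (P := ⟨X, 𝒰⟩) h.left hm y)
      (fun hn => exists_factor_ultraSumMap (P := ⟨X, 𝒰⟩) h.right hn y)
  · obtain ⟨𝒰, x, hx⟩ := exists_factor_ultraSum B hT (y ≫ ultraSumMap B m)
    exact 𝒰.not_mk_mem_and_mk_mem h
      ⟨mk_mem_of_factor_ultraSumMap (P := ⟨X, 𝒰⟩) hT h.left hx.symm,
        mk_mem_of_factor_ultraSumMap (P := ⟨X, 𝒰⟩) hT h.right (e.symm.trans hx.symm)⟩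

variable (B) in
theorem preservesFiniteCoproducts_ultraSumFunctor :
    PreservesFiniteCoproducts (ultraSumFunctor B) := by
  have h2 : ∀ X Y : C, PreservesColimit (pair X Y) (ultraSumFunctor B) := fun X Y =>
    preservesColimit_of_preserves_colimit_cocone (coprodIsCoprod X Y)
      ((isColimitMapCoconeBinaryCofanEquiv (ultraSumFunctor B) _ _).symm
        (isCoproduct_ultraSumMap B hE (Summand.isCoproduct_inl_inr X Y)).some)
  have : PreservesColimitsOfShape (Discrete WalkingPair) (ultraSumFunctor B) :=
    ⟨fun {K} => preservesColimit_of_iso_diagram _ (diagramIsoPair K).symm⟩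
  -- The initial object carries no ultrafilter, so the sum over it is empty.
  have h0 : IsInitial ((ultraSumFunctor B).obj (⊥_ C)) :=
    IsInitial.ofUniqueHom (fun Z => ultraSumDesc isEmptyElim)
      fun Z m => ultraSum_hom_ext isEmptyElim
  have : PreservesColimit (Functor.empty C) (ultraSumFunctor B) :=
    preservesColimit_of_preserves_colimit_cocone initialIsInitial
      ((isColimitMapCoconeEmptyCoconeEquiv (ultraSumFunctor B) _).symm h0)
  have := preservesColimitsOfShape_pempty_of_preservesInitial (ultraSumFunctor B)
  exact ⟨fun n => PreservesFiniteCoproducts.of_preserves_binary_and_initial _ _⟩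

end Sum

/-! ### Comparison of stalks and sums -/

section Comparison

variable {C : Type u} [Category.{w} C] [FinitaryExtensive C] {E : Type u₁} [Category.{w} E]

/-- Two presentations of the same stalk are isomorphic. -/
theorem IsStalk.exists_iso {F : C ⥤ E} [PreservesFiniteCoproducts F] {P : UF C} {S S' : E}
    {j : S ⟶ F.obj P.obj} {j' : S' ⟶ F.obj P.obj} (hE : HasConnectedDecompositions E)
    (h : IsStalk F P j) (h' : IsStalk F P j') : ∃ e : S ≅ S', e.hom ≫ j' = j := by
  have := h.mono
  have := h'.mono
  obtain ⟨a, ha⟩ := hE.exists_lift j' j fun T hT x =>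
    (h'.factors_iff hT _).2 (h.elementUltrafilter_eq hT x)
  obtain ⟨b, hb⟩ := hE.exists_lift j j' fun T hT x =>
    (h.factors_iff hT _).2 (h'.elementUltrafilter_eq hT x)
  exact ⟨⟨a, b, by rw [← cancel_mono j, Category.assoc, hb, ha, Category.id_comp],
    by rw [← cancel_mono j', Category.assoc, ha, hb, Category.id_comp]⟩, ha⟩

variable [HasCoproducts.{w} E]

section Trans

variable {B B' B'' : UF C ⥤ E}

/-- The action of a transformation on `ultraSum`. -/
noncomputable def ultraSumTrans (γ : B ⟶ B') (X : C) : ultraSum B X ⟶ ultraSum B' X :=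
  ultraSumDesc fun 𝒰 => γ.app ⟨X, 𝒰⟩ ≫ ultraSumι B' ⟨X, 𝒰⟩

theorem ultraSumι_trans (γ : B ⟶ B') (P : UF C) :
    ultraSumι B P ≫ ultraSumTrans γ P.obj = γ.app P ≫ ultraSumι B' P :=
  ultraSumι_desc _ _

/-- `ultraSumTrans` as a natural transformation. -/
noncomputable def ultraSumNatTrans (γ : B ⟶ B') : ultraSumFunctor B ⟶ ultraSumFunctor B' where
  app := ultraSumTrans γ
  naturality X Y f := ultraSum_hom_ext fun 𝒰 => by
    change ultraSumι B ⟨X, 𝒰⟩ ≫ ultraSumMap B f ≫ ultraSumTrans γ Y =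
      ultraSumι B ⟨X, 𝒰⟩ ≫ ultraSumTrans γ X ≫ ultraSumMap B' f
    rw [← Category.assoc, ultraSumι_map (P := ⟨X, 𝒰⟩) (Q := ⟨Y, 𝒰.push f⟩) B f rfl,
      Category.assoc, ultraSumι_trans γ ⟨Y, 𝒰.push f⟩, ← Category.assoc (ultraSumι B ⟨X, 𝒰⟩),
      ultraSumι_trans γ ⟨X, 𝒰⟩, Category.assoc,
      ultraSumι_map (P := ⟨X, 𝒰⟩) (Q := ⟨Y, 𝒰.push f⟩) B' f rfl, γ.naturality_assoc]

theorem ultraSumTrans_id (X : C) : ultraSumTrans (𝟙 B) X = 𝟙 _ :=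
  ultraSum_hom_ext fun 𝒰 => by
    rw [ultraSumι_trans (𝟙 B) ⟨X, 𝒰⟩, NatTrans.id_app, Category.id_comp, Category.comp_id]

theorem ultraSumTrans_comp (γ : B ⟶ B') (δ : B' ⟶ B'') (X : C) :
    ultraSumTrans (γ ≫ δ) X = ultraSumTrans γ X ≫ ultraSumTrans δ X :=
  ultraSum_hom_ext fun 𝒰 => by
    rw [ultraSumι_trans (γ ≫ δ) ⟨X, 𝒰⟩, NatTrans.comp_app, Category.assoc,
      ← Category.assoc (ultraSumι B ⟨X, 𝒰⟩), ultraSumι_trans γ ⟨X, 𝒰⟩, Category.assoc,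
      ultraSumι_trans δ ⟨X, 𝒰⟩]

end Trans

variable (hE : HasConnectedDecompositions E)

/-! ### Recovering a functor from its stalks -/

section SumOfStalks

variable (F F' : C ⥤ E) [PreservesFiniteCoproducts F] [PreservesFiniteCoproducts F']

/-- The stalks of `F`, as a functor on `UF C`. -/
noncomputable abbrev stalkPresheaf : UF C ⥤ E where
  obj := stalk hE F
  map := stalkMap hE F
  map_id := stalkMap_id hE F
  map_comp := stalkMap_comp hE F

/-- The comparison `∑_𝒰 ⋂_{U ∈ 𝒰} F U ⟶ F X`. -/
noncomputable def sumStalk (X : C) : ultraSum (stalkPresheaf hE F) X ⟶ F.obj X :=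
  ultraSumDesc fun 𝒰 => stalkι hE F ⟨X, 𝒰⟩

theorem ultraSumι_sumStalk (P : UF C) :
    ultraSumι (stalkPresheaf hE F) P ≫ sumStalk hE F P.obj = stalkι hE F P :=
  ultraSumι_desc _ _

/-- An element `y` of `F X` lies in the stalk at its own ultrafilter and in no other. -/
instance isIso_sumStalk (X : C) : IsIso (sumStalk hE F X) := by
  refine hE.isIso fun T hT y => ?_
  obtain ⟨s, hs⟩ := ((isStalk_stalkι hE F ⟨X, elementUltrafilter F hT y⟩).factors_iff hT y).2 rfl
  refine ⟨s ≫ ultraSumι (stalkPresheaf hE F) ⟨X, elementUltrafilter F hT y⟩, ?_, fun z hz => ?_⟩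
  · exact (Category.assoc _ _ _).trans ((congrArg (s ≫ ·) (ultraSumι_sumStalk hE F _)).trans hs)
  · obtain ⟨𝒱, z, rfl⟩ := exists_factor_ultraSum _ hT z
    dsimp only at hz
    rw [Category.assoc, ultraSumι_sumStalk hE F ⟨X, 𝒱⟩] at hz
    obtain rfl : elementUltrafilter F hT y = 𝒱 :=
      (congrArg (elementUltrafilter F hT) hz.symm).trans
        ((isStalk_stalkι hE F ⟨X, 𝒱⟩).elementUltrafilter_eq hT z)
    rw [(cancel_mono (stalkι hE F ⟨X, elementUltrafilter F hT y⟩)).1 (hz.trans hs.symm)]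

theorem ultraSumMap_sumStalk {X Y : C} (f : X ⟶ Y) :
    ultraSumMap (stalkPresheaf hE F) f ≫ sumStalk hE F Y = sumStalk hE F X ≫ F.map f :=
  ultraSum_hom_ext fun 𝒰 => by
    rw [← Category.assoc,
      ultraSumι_map (P := ⟨X, 𝒰⟩) (Q := ⟨Y, 𝒰.push f⟩) (stalkPresheaf hE F) f rfl,
      Category.assoc, ultraSumι_sumStalk hE F ⟨Y, 𝒰.push f⟩,
      ← Category.assoc (ultraSumι (stalkPresheaf hE F) ⟨X, 𝒰⟩),
      ultraSumι_sumStalk hE F ⟨X, 𝒰⟩]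
    exact stalkMap_total hE F (P := ⟨X, 𝒰⟩) (Q := ⟨Y, 𝒰.push f⟩) f rfl

/-- The isomorphism `∑_𝒰 ⋂_{U ∈ 𝒰} F U ≅ F X`, naturally in `X`. -/
noncomputable def sumStalkIso : ultraSumFunctor (stalkPresheaf hE F) ≅ F :=
  NatIso.ofComponents (fun X => asIso (sumStalk hE F X)) fun f => ultraSumMap_sumStalk hE F f

variable {F F'}

/-- The restriction of a transformation to stalks, as a transformation of functors on `UF C`. -/
noncomputable def stalkNatTrans (α : F ⟶ F') : stalkPresheaf hE F ⟶ stalkPresheaf hE F' where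
  app := stalkTrans hE α
  naturality _ _ q := stalkTrans_naturality hE α q

theorem sumStalk_naturality (α : F ⟶ F') (X : C) :
    ultraSumTrans (stalkNatTrans hE α) X ≫ sumStalk hE F' X = sumStalk hE F X ≫ α.app X :=
  ultraSum_hom_ext fun 𝒰 => by
    rw [← Category.assoc, ultraSumι_trans (stalkNatTrans hE α) ⟨X, 𝒰⟩, Category.assoc,
      ultraSumι_sumStalk hE F' ⟨X, 𝒰⟩, ← Category.assoc, ultraSumι_sumStalk hE F ⟨X, 𝒰⟩]
    exact stalkTrans_ι hE α ⟨X, 𝒰⟩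

end SumOfStalks

/-! ### Recovering `B` from the stalks of its sum -/

section StalksOfSum

variable (B B' : UF C ⥤ E) [PreservesFiniteCoproducts (ultraSumFunctor B)]
  [PreservesFiniteCoproducts (ultraSumFunctor B')]

include hE in
-- Elements of the summand at `𝒰` have ultrafilter `𝒰`, since they lift to every member of `𝒰`; an
-- element with ultrafilter `𝒰` can then lie in no other summand.
theorem isStalk_ultraSumι (P : UF C) : IsStalk (ultraSumFunctor B) P (ultraSumι B P) where
  mono := mono_ultraSumι B hE P
  factors_iff T hT x := by
    have key : ∀ (Q : UF C) (y : T ⟶ B.obj Q),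
        elementUltrafilter (ultraSumFunctor B) hT (X := Q.obj) (y ≫ ultraSumι B Q) = Q.uf := by
      refine fun Q y => (UltrafilterOn.eq_of_le fun U hU => ?_).symm
      exact exists_factor_ultraSumMap U.arrow_isCoprojection (by rwa [U.mk_arrow]) y
    constructor
    · rintro ⟨y, rfl⟩
      exact key P y
    · intro h
      obtain ⟨X, 𝒰⟩ := P
      obtain ⟨𝒱, y, rfl⟩ := exists_factor_ultraSum B hT x
      have transport : ∀ 𝒲 : UltrafilterOn X, 𝒱 = 𝒲 →
          ∃ z, z ≫ ultraSumι B ⟨X, 𝒲⟩ = y ≫ ultraSumι B ⟨X, 𝒱⟩ := by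
        rintro _ rfl
        exact ⟨y, rfl⟩
      exact transport 𝒰 ((key ⟨X, 𝒱⟩ y).symm.trans h)

/-- The isomorphism between the stalk of `∫ B` at `P` and `B P`. -/
noncomputable def stalkUltraSumIso (P : UF C) : stalk hE (ultraSumFunctor B) P ≅ B.obj P :=
  ((isStalk_stalkι hE (ultraSumFunctor B) P).exists_iso hE (isStalk_ultraSumι hE B P)).choose

theorem stalkUltraSumIso_hom_ι (P : UF C) :
    (stalkUltraSumIso hE B P).hom ≫ ultraSumι B P = stalkι hE (ultraSumFunctor B) P :=
  ((isStalk_stalkι hE (ultraSumFunctor B) P).exists_iso hE (isStalk_ultraSumι hE B P)).choose_spec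

theorem stalkUltraSumIso_naturality {P Q : UF C} (q : P ⟶ Q) :
    stalkMap hE (ultraSumFunctor B) q ≫ (stalkUltraSumIso hE B Q).hom =
      (stalkUltraSumIso hE B P).hom ≫ B.map q := by
  obtain ⟨f, rfl⟩ : ∃ f : PartialMap P Q, f.toHom = q := Quotient.exists_rep q
  have hQ := mono_ultraSumι B hE Q
  have hi := UF.isIso_total (P := f.domUF) f.incl f.isCoprojection f.push_incl
  -- An explicit lift of the stalk to the domain of `f`, obtained by inverting the inclusion of the
  -- domain in `UF C`.
  let l : stalk hE (ultraSumFunctor B) P ⟶ ultraSum B f.dom := (stalkUltraSumIso hE B P).hom ≫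
    inv (B.map (UF.total (P := f.domUF) f.incl f.push_incl)) ≫ ultraSumι B f.domUF
  have hl : l ≫ ultraSumMap B f.incl = stalkι hE (ultraSumFunctor B) P := by
    rw [Category.assoc, Category.assoc,
      inv_map_total_ultraSumι_map (P := P) (Q := f.domUF) f.incl f.push_incl,
      stalkUltraSumIso_hom_ι]
  have h := stalkMap_toHom hE (ultraSumFunctor B) f l hl
  rw [← cancel_mono (ultraSumι B Q), Category.assoc, stalkUltraSumIso_hom_ι, h]
  change l ≫ ultraSumMap B f.map = _
  rw [Category.assoc, Category.assoc, ultraSumι_map (P := f.domUF) B f.map f.push_map,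
    ← f.total_incl_comp, B.map_comp, Category.assoc, IsIso.inv_hom_id_assoc, Category.assoc]

/-- The stalks of `∫ B` are the values of `B`. -/
noncomputable def stalkPresheafUltraSumIso : stalkPresheaf hE (ultraSumFunctor B) ≅ B :=
  NatIso.ofComponents (stalkUltraSumIso hE B) fun q => stalkUltraSumIso_naturality hE B q

variable {B B'}

theorem stalkUltraSumIso_naturality_trans (γ : B ⟶ B') (P : UF C) :
    stalkTrans hE (ultraSumNatTrans γ) P ≫ (stalkUltraSumIso hE B' P).hom =
      (stalkUltraSumIso hE B P).hom ≫ γ.app P := by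
  have := mono_ultraSumι B' hE P
  rw [← cancel_mono (ultraSumι B' P), Category.assoc, stalkUltraSumIso_hom_ι, stalkTrans_ι,
    Category.assoc, ← ultraSumι_trans, ← Category.assoc, stalkUltraSumIso_hom_ι]
  rfl

end StalksOfSum

end Comparison

/-! ### The equivalence -/

section Equivalence

variable {C : Type u} [Category.{w} C] [FinitaryExtensive C] {E : Type u₁} [Category.{w} E]

instance (A : FC C E) : PreservesFiniteCoproducts A.obj := A.property

variable [HasCoproducts.{w} E] (hE : HasConnectedDecompositions E)

/-- The functor `A ↦ Ã`. -/
noncomputable def stalkFunctor : FC C E ⥤ (UF C ⥤ E) where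
  obj A := stalkPresheaf hE A.obj
  map α := stalkNatTrans hE α.hom
  map_id A := by
    ext P
    refine (cancel_mono (stalkι hE A.obj P)).1 ((stalkTrans_ι hE _ P).trans ?_)
    exact (Category.comp_id _).trans (Category.id_comp _).symm
  map_comp {A A' A''} α β := by
    ext P
    refine (cancel_mono (stalkι hE A''.obj P)).1 ((stalkTrans_ι hE _ P).trans ?_)
    change stalkι hE A.obj P ≫ α.hom.app P.obj ≫ β.hom.app P.obj =
      (stalkTrans hE α.hom P ≫ stalkTrans hE β.hom P) ≫ stalkι hE A''.obj P
    rw [Category.assoc, stalkTrans_ι, ← Category.assoc, ← Category.assoc, stalkTrans_ι]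

/-- The functor `B ↦ ∫ B`. -/
noncomputable def integral : (UF C ⥤ E) ⥤ FC C E where
  obj B := ⟨ultraSumFunctor B, preservesFiniteCoproducts_ultraSumFunctor B hE⟩
  map γ := ObjectProperty.homMk (ultraSumNatTrans γ)
  map_id B := by
    ext X
    exact ultraSumTrans_id X
  map_comp γ δ := by
    ext X
    exact ultraSumTrans_comp γ δ X

theorem isIntersectionOfImages_stalkFunctor :
    IsIntersectionOfImages (stalkFunctor (C := C) hE) fun A P => stalkι hE A.obj P where
  isIntersection A P := hE.isIntersection (isStalk_stalkι hE A.obj P)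
  map_partialMap A _ _ f l hl := stalkMap_toHom hE A.obj f l hl
  map_natTrans α P := stalkTrans_ι hE α.hom P

theorem isSumOverUltrafilters_integral :
    IsSumOverUltrafilters (integral (C := C) hE) fun B X 𝒰 => ultraSumι B ⟨X, 𝒰⟩ where
  isCoproduct B X := ⟨ultraSumIsColimit B X⟩
  map_hom B X Y f 𝒰 := ultraSumι_map (P := ⟨X, 𝒰⟩) (Q := ⟨Y, 𝒰.push f⟩) B f rfl
  map_natTrans γ X 𝒰 := ultraSumι_trans γ ⟨X, 𝒰⟩

/-- The isomorphisms `A ≅ ∫ Ã`. -/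
noncomputable def unitNatIso : 𝟭 (FC C E) ≅ stalkFunctor hE ⋙ integral hE :=
  (NatIso.ofComponents (F := stalkFunctor hE ⋙ integral hE) (G := 𝟭 (FC C E))
    (fun A => ObjectProperty.isoMk _ (sumStalkIso hE A.obj)) fun α => by
      ext X
      exact sumStalk_naturality hE α.hom X).symm

/-- The isomorphisms between the stalks of `∫ B` and the values of `B`. -/
noncomputable def counitNatIso : integral hE ⋙ stalkFunctor hE ≅ 𝟭 (UF C ⥤ E) :=
  NatIso.ofComponents
    (fun B =>
      have := preservesFiniteCoproducts_ultraSumFunctor B hE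
      stalkPresheafUltraSumIso hE B)
    fun {B B'} γ => by
      have := preservesFiniteCoproducts_ultraSumFunctor B hE
      have := preservesFiniteCoproducts_ultraSumFunctor B' hE
      ext P
      exact stalkUltraSumIso_naturality_trans hE γ P

/-- The equivalence between finite-coproduct-preserving functors on `C` and functors on `UF C`. -/
noncomputable def stalkEquivalence : FC C E ≌ (UF C ⥤ E) :=
  CategoryTheory.Equivalence.mk (stalkFunctor hE) (integral hE) (unitNatIso hE) (counitNatIso hE)

/-- `Equivalence.mk` adjusts the unit to obtain the triangle identity but keeps the given counit, so
the compatibility built into `stalkUltraSumIso` survives. -/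
theorem stalkEquivalence_counit_ι (B : UF C ⥤ E) (P : UF C) :
    ((stalkEquivalence hE).counit.app B).app P ≫ ultraSumι B P =
      stalkι hE ((integral hE).obj B).obj P :=
  have := preservesFiniteCoproducts_ultraSumFunctor B hE
  stalkUltraSumIso_hom_ι hE B P

end Equivalence

end ExtensiveUltrafilters

theorem theorem8 {C : Type u} [Category.{w} C] [FinitaryExtensive C]
    {E : Type u₁} [Category.{w} E] (hE : IsGrothendieckTopos E) (hlc : IsLocallyConnected E) :
    ∃ (e : FC C E ≌ (UF C ⥤ E))
      (j : ∀ (A : FC C E) (P : UF C), (e.functor.obj A).obj P ⟶ A.obj.obj P.obj)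
      (i : ∀ (B : UF C ⥤ E) (X : C) (𝒰 : UltrafilterOn X),
        B.obj ⟨X, 𝒰⟩ ⟶ (e.inverse.obj B).obj.obj X),
      IsIntersectionOfImages e.functor j ∧
      IsSumOverUltrafilters e.inverse i ∧
      ∀ (B : UF C ⥤ E) (X : C) (𝒰 : UltrafilterOn X),
        (e.counit.app B).app ⟨X, 𝒰⟩ ≫ i B X 𝒰 = j (e.inverse.obj B) ⟨X, 𝒰⟩ := by
  have := hE.hasCoproducts
  have hd := hE.hasConnectedDecompositions hlc
  exact ⟨stalkEquivalence hd, fun A P => stalkι hd A.obj P, fun B X 𝒰 => ultraSumι B ⟨X, 𝒰⟩,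
    isIntersectionOfImages_stalkFunctor hd, isSumOverUltrafilters_integral hd,
    fun B X 𝒰 => stalkEquivalence_counit_ι hd B ⟨X, 𝒰⟩⟩
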